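/- A (finite) ribbon graph $G$ is a possibly non-orientable surface with boundary, written as the union of a finite set of vertex discs and a finite set of edge discs, such that vertices and edges meet in disjoint line segments (the *common line segments*), each of which lies on the boundary of exactly one vertex and exactly one edge, and each edge contains exactly two of them. The common line segments cut the vertex boundaries into *vertex line segments*, and the rest of the boundary of each edge consists of two *edge line segments*. Two ribbon graphs are *equivalent* if there is a homeomorphism between them that maps vertices to vertices and edges to edges. $G$ is *checkerboard colourable* if its boundary components can be assigned two colours such that the two edge line segments of each edge always lie on boundary components of different colours. For an edge $e$, the partial dual $G^{e}$ arises by interchanging the roles of the common line segments and the edge line segments of $e$ (in an arrow presentation, where $e$ is a pair of arrows $e',e''$ on the vertex circles: join the head of $e'$ to the tail of $e''$ and the head of $e''$ to the tail of $e'$ by new arrows labelled $e$, and delete $e',e''$ with the arcs containing them), and the contraction is $G/e = G^{e}-e$. The contraction $G/e$ is *proper* unless $e$ is an orientable loop and the minimum, over the two arcs of the boundary of its vertex between the two common line segments of $e$, of the number of common line segments strictly inside the arc is odd. *Evenly splitting a vertex* $v$ means: choose two different vertex line segments on the boundary of $v$ such that at least one of the two arcs of this boundary between them contains an even number of common line segments;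 put on each of them a marking arrow of a new edge $e$ such that both arrows point in the same direction round $v$; and contract $e$. A ribbon graph $H$ is an *Eulerian minor* of $G$ if it is obtained from $G$ by a finite (possibly empty) sequence of proper edge contractions, deletions of connected components, and even vertex splittings. Let $B_1^{\ast}$ be the ribbon graph with two vertices joined by one edge (the geometric dual of the one-vertex ribbon graph $B_1$ with a single, orientable loop), let $B_{\overline{1}}$ be the ribbon graph with one vertex and a single, non-orientable loop, and let $B_3-e$ be the ribbon graph with one vertex and two orientable loops whose ends alternate round the vertex (that is, $B_3$, which has one vertex and three orientable loops whose ends appear in the cyclic order $1,2,3,1,2,3$, with one edge deleted). **Theorem.** A ribbon graph is checkerboard colourable if and only if it contains no Eulerian minor equivalent to $B_1^{\ast}$, $B_{\overline{1}}$ or $B_3-e$. -/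

import Mathlib

universe u v

/-- A finite ribbon graph, given by the line segments into which the common line segments cut the
boundaries of its vertex discs and edge discs. A *flag* is an end point of a common line segment.
At every flag exactly one common line segment, one vertex line segment and one edge line segment
meet, and `com`, `ver`, `edg` send a flag to the other end point of that segment.

The boundary of an edge disc consists of two common and two edge line segments in alternation,
so it passes through the four distinct flags `x`, `com x`, `com (edg x)`, `edg x`.
The boundary of a vertex disc that meets some edge alternates between common and vertex line
segments, and a boundary component of the surface alternates between edge and vertex line segments.
`isolated` is the number of vertex discs that meet no edge.

In terms of arrow presentations, the two flags of a common line segment are head and tail of a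
marking arrow, and `edg` sends the head of a marking arrow to the tail of the other marking arrow
with the same label. -/
structure RibbonGraph : Type (u + 1) where
  Flag : Type u
  finite : Finite Flag
  com : Flag → Flag
  ver : Flag → Flag
  edg : Flag → Flag
  com_com : ∀ x, com (com x) = x
  ver_ver : ∀ x, ver (ver x) = x
  edg_edg : ∀ x, edg (edg x) = x
  com_ne : ∀ x, com x ≠ x
  ver_ne : ∀ x, ver x ≠ x
  edg_ne : ∀ x, edg x ≠ x
  com_edg : ∀ x, com (edg x) = edg (com x)
  com_edg_ne : ∀ x, com (edg x) ≠ x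
  isolated : ℕ

namespace RibbonGraph

/-- Two ribbon graphs are equivalent if there is a homeomorphism between them that maps vertex discs
to vertex discs and edge discs to edge discs; equivalently, a bijection of the flags that respects
the three kinds of line segments, together with a bijection of the isolated vertices. -/
def Equivalent (G : RibbonGraph.{u}) (H : RibbonGraph.{v}) : Prop :=
  G.isolated = H.isolated ∧
    ∃ φ : G.Flag ≃ H.Flag, ∀ x,
      φ (G.com x) = H.com (φ x) ∧ φ (G.ver x) = H.ver (φ x) ∧ φ (G.edg x) = H.edg (φ x)

section Basic

variable (G : RibbonGraph.{u})

/-- Flags on the boundary of the same vertex disc. -/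
def vertexSetoid : Setoid G.Flag :=
  Relation.EqvGen.setoid fun x y => y = G.com x ∨ y = G.ver x

/-- Flags on the same boundary component of the surface. -/
def boundarySetoid : Setoid G.Flag :=
  Relation.EqvGen.setoid fun x y => y = G.edg x ∨ y = G.ver x

/-- Flags in the same connected component. -/
def componentSetoid : Setoid G.Flag :=
  Relation.EqvGen.setoid fun x y => y = G.com x ∨ y = G.ver x ∨ y = G.edg x

/-- The boundary components of `G`: each isolated vertex contributes its bounding circle. -/
def BoundaryComponent : Type u :=
  Quotient G.boundarySetoid ⊕ Fin G.isolated

/-- The boundary component through a flag, which contains the edge line segment at that flag. -/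
def boundaryOf (x : G.Flag) : G.BoundaryComponent :=
  Sum.inl (Quotient.mk G.boundarySetoid x)

/-- The boundary components can be coloured with two colours so that the two edge line segments of
each edge get different colours. The edge line segments of the edge of `x` are the one at `x` and
the one at `com x`. -/
def CheckerboardColourable : Prop :=
  ∃ κ : G.BoundaryComponent → Bool,
    ∀ x : G.Flag, κ (G.boundaryOf x) ≠ κ (G.boundaryOf (G.com x))

/-- The four flags of the edge that has `x` as a flag. Edges are named by any one of their flags. -/
def edgeFlags (x : G.Flag) : Set G.Flag :=
  {x, G.com x, G.edg x, G.com (G.edg x)}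

theorem com_mem_edgeFlags {x y : G.Flag} (h : y ∈ G.edgeFlags x) : G.com y ∈ G.edgeFlags x := by
  simp only [edgeFlags, Set.mem_insert_iff, Set.mem_singleton_iff] at h ⊢
  have h1 := G.com_com
  grind

theorem edg_mem_edgeFlags {x y : G.Flag} (h : y ∈ G.edgeFlags x) : G.edg y ∈ G.edgeFlags x := by
  simp only [edgeFlags, Set.mem_insert_iff, Set.mem_singleton_iff] at h ⊢
  have h1 := G.edg_edg
  have h2 := G.com_edg
  grind

open scoped Classical in
/-- The partial dual with respect to the edges whose flags form the set `A`: on these edges, the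
common line segments and the edge line segments trade places. -/
noncomputable def partialDual (A : Set G.Flag)
    (hA : ∀ x ∈ A, G.com x ∈ A ∧ G.edg x ∈ A) : RibbonGraph.{u} where
  Flag := G.Flag
  finite := G.finite
  com x := if x ∈ A then G.edg x else G.com x
  ver := G.ver
  edg x := if x ∈ A then G.com x else G.edg x
  com_com x := by
    have h1 := G.com_com; have h2 := G.edg_edg; grind
  ver_ver := G.ver_ver
  edg_edg x := by
    have h1 := G.com_com; have h2 := G.edg_edg; grind
  com_ne x := by
    have h1 := G.com_ne; have h2 := G.edg_ne; grind
  ver_ne := G.ver_ne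
  edg_ne x := by
    have h1 := G.com_ne; have h2 := G.edg_ne; grind
  com_edg x := by
    have h1 := G.com_com; have h2 := G.edg_edg; have h3 := G.com_edg; grind
  com_edg_ne x := by
    have h1 := G.com_com; have h2 := G.edg_edg; have h3 := G.com_edg; have h4 := G.com_edg_ne
    grind
  isolated := G.isolated

/-- The geometric dual. -/
noncomputable def dual : RibbonGraph.{u} :=
  G.partialDual Set.univ fun _ _ => ⟨trivial, trivial⟩

open scoped Classical in
/-- The other end of the vertex line segment that starts at the flag `y` once the edge of `x` has
been removed: whenever the way along the vertex boundary runs into one of the two common line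
segments of that edge, it continues across it. -/
noncomputable def verDelete (x y : G.Flag) : G.Flag :=
  if G.ver y ∉ G.edgeFlags x then G.ver y
  else if G.ver (G.com (G.ver y)) ∉ G.edgeFlags x then G.ver (G.com (G.ver y))
  else G.ver (G.com (G.ver (G.com (G.ver y))))

theorem verDelete_spec (x y : G.Flag) (hy : y ∉ G.edgeFlags x) :
    G.verDelete x y ∉ G.edgeFlags x ∧ G.verDelete x (G.verDelete x y) = y ∧
      G.verDelete x y ≠ y := by
  have hc : ∀ z ∈ G.edgeFlags x, G.com z ∈ G.edgeFlags x := fun _ => G.com_mem_edgeFlags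
  have c1 := G.com_com
  have c2 := G.ver_ver
  have c3 := G.com_ne
  have c4 := G.ver_ne
  have key : ∀ z w, z ∈ G.edgeFlags x → w ∈ G.edgeFlags x → w ≠ z → w ≠ G.com z →
      ∀ t ∈ G.edgeFlags x, t = z ∨ t = G.com z ∨ t = w ∨ t = G.com w := by
    intro z w hz hw h1 h2 t ht
    simp only [edgeFlags, Set.mem_insert_iff, Set.mem_singleton_iff] at hz hw ht
    grind
  have e1 : ∀ z, G.ver z ∉ G.edgeFlags x → G.verDelete x z = G.ver z := by
    intro z h; simp only [verDelete, h, not_false_eq_true, if_true]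
  have e2 : ∀ z, G.ver z ∈ G.edgeFlags x → G.ver (G.com (G.ver z)) ∉ G.edgeFlags x →
      G.verDelete x z = G.ver (G.com (G.ver z)) := by
    intro z h h'; simp only [verDelete, h, h', not_false_eq_true, not_true, if_true, if_false]
  have e3 : ∀ z, G.ver z ∈ G.edgeFlags x → G.ver (G.com (G.ver z)) ∈ G.edgeFlags x →
      G.verDelete x z = G.ver (G.com (G.ver (G.com (G.ver z)))) := by
    intro z h h'; simp only [verDelete, h, h', not_true, if_false]
  by_cases h1 : G.ver y ∈ G.edgeFlags x
  · by_cases h2 : G.ver (G.com (G.ver y)) ∈ G.edgeFlags x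
    · have h3 : G.ver (G.com (G.ver (G.com (G.ver y)))) ∉ G.edgeFlags x := by
        intro h3
        have := key _ _ h1 h2 (by grind) (by grind) _ h3
        grind
      rw [e3 y h1 h2]
      refine ⟨h3, ?_, by grind⟩
      rw [e3 _ (by simpa only [c2] using hc _ h2) (by simpa only [c1, c2] using hc _ h1)]
      simp only [c1, c2]
    · rw [e2 y h1 h2]
      refine ⟨h2, ?_, by grind⟩
      rw [e2 _ (by simpa only [c2] using hc _ h1) (by simpa only [c1, c2] using hy)]
      simp only [c1, c2]
  · rw [e1 y h1]
    refine ⟨h1, ?_, c4 y⟩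
    rw [e1 _ (by simpa only [c2] using hy), c2]

/-- Deletion of the edge of `x`. Vertices all of whose flags belong to that edge become isolated. -/
noncomputable def deleteEdge (x : G.Flag) : RibbonGraph.{u} where
  Flag := {y : G.Flag // y ∉ G.edgeFlags x}
  finite := by have := G.finite; infer_instance
  com y := ⟨G.com y.1, fun h => y.2 (by simpa [G.com_com] using G.com_mem_edgeFlags h)⟩
  ver y := ⟨G.verDelete x y.1, (G.verDelete_spec x y.1 y.2).1⟩
  edg y := ⟨G.edg y.1, fun h => y.2 (by simpa [G.edg_edg] using G.edg_mem_edgeFlags h)⟩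
  com_com y := Subtype.ext (G.com_com y.1)
  ver_ver y := Subtype.ext (G.verDelete_spec x y.1 y.2).2.1
  edg_edg y := Subtype.ext (G.edg_edg y.1)
  com_ne y h := G.com_ne y.1 (congrArg Subtype.val h)
  ver_ne y h := (G.verDelete_spec x y.1 y.2).2.2 (congrArg Subtype.val h)
  edg_ne y h := G.edg_ne y.1 (congrArg Subtype.val h)
  com_edg y := Subtype.ext (G.com_edg y.1)
  com_edg_ne y h := G.com_edg_ne y.1 (congrArg Subtype.val h)
  isolated := G.isolated +
    Nat.card {w : Quotient G.vertexSetoid //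
      ∀ y, Quotient.mk G.vertexSetoid y = w → y ∈ G.edgeFlags x}

/-- Contraction `G / e`, which is `G ^ e - e`, for the edge `e` of `x`. -/
noncomputable def contract (x : G.Flag) : RibbonGraph.{u} :=
  (G.partialDual (G.edgeFlags x)
    fun _ h => ⟨G.com_mem_edgeFlags h, G.edg_mem_edgeFlags h⟩).deleteEdge x

/-- Deletion of the connected component of the flag `x`. -/
def deleteComponent (x : G.Flag) : RibbonGraph.{u} where
  Flag := {y : G.Flag // ¬ G.componentSetoid x y}
  finite := by have := G.finite; infer_instance
  com y := ⟨G.com y.1, fun h => y.2 (G.componentSetoid.trans h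
    (G.componentSetoid.symm (.rel _ _ (.inl rfl))))⟩
  ver y := ⟨G.ver y.1, fun h => y.2 (G.componentSetoid.trans h
    (G.componentSetoid.symm (.rel _ _ (.inr (.inl rfl)))))⟩
  edg y := ⟨G.edg y.1, fun h => y.2 (G.componentSetoid.trans h
    (G.componentSetoid.symm (.rel _ _ (.inr (.inr rfl)))))⟩
  com_com y := Subtype.ext (G.com_com y.1)
  ver_ver y := Subtype.ext (G.ver_ver y.1)
  edg_edg y := Subtype.ext (G.edg_edg y.1)
  com_ne y h := G.com_ne y.1 (congrArg Subtype.val h)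
  ver_ne y h := G.ver_ne y.1 (congrArg Subtype.val h)
  edg_ne y h := G.edg_ne y.1 (congrArg Subtype.val h)
  com_edg y := Subtype.ext (G.com_edg y.1)
  com_edg_ne y h := G.com_edg_ne y.1 (congrArg Subtype.val h)
  isolated := G.isolated

/-- Deletion of a connected component that is an isolated vertex
(meant for `G.isolated ≠ 0`). -/
def deleteIsolated : RibbonGraph.{u} :=
  { G with isolated := G.isolated - 1 }

/-- `n` is the number of steps that the map `f` first needs to get from `a` to `b`. -/
def FirstHit {α : Type u} (f : α → α) (a b : α) (n : ℕ) : Prop :=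
  f^[n] a = b ∧ ∀ m < n, f^[m] a ≠ b

/-- Going round a vertex boundary, from the flag where a common line segment is entered
to the flag where the next common line segment is entered. -/
def nextCommon (x : G.Flag) : G.Flag := G.ver (G.com x)

/-- Going round a vertex boundary, from the flag where a vertex line segment is entered
to the flag where the next vertex line segment is entered. -/
def nextVertexSegment (x : G.Flag) : G.Flag := G.com (G.ver x)

/-- The edge of `x` is an orientable loop whose two common line segments have dual distance `k`.
Going round the vertex boundary so that the common line segment at `x` is traversed from `x` to
`com x`, the other common line segment of an orientable loop is entered at `com (edg x)` (as `edg`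
joins the head of each marking arrow to the tail of the other one); a non-orientable loop would be
entered at `edg x`. The numbers `n` and `m` count the common line segments strictly between the two
on the two arcs of the vertex boundary, and the dual distance is the smaller one. -/
def OrientableLoopWithDualDistance (x : G.Flag) (k : ℕ) : Prop :=
  ∃ n m : ℕ, FirstHit G.nextCommon x (G.com (G.edg x)) (n + 1) ∧
    FirstHit G.nextCommon (G.com (G.edg x)) x (m + 1) ∧ k = min n m

/-- Contraction of the edge of `x` is proper: that edge is not an orientable loop whose common line
segments have odd dual distance. -/
def ProperContraction (x : G.Flag) : Prop :=
  ¬ ∃ k, Odd k ∧ G.OrientableLoopWithDualDistance x k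

open scoped Classical in
/-- Add an edge with one marking arrow on the vertex line segment from `a` to `ver a`, and the
other one on the (different) vertex line segment from `b` to `ver b`, each pointing in the
stated direction. The new flag `(i, h)` is the tail (`h = false`) or the head (`h = true`) of
the first (`i = false`) or second (`i = true`) new arrow. -/
noncomputable def addEdge (a b : G.Flag) (hab : a ≠ b) (hab' : G.ver a ≠ b) : RibbonGraph.{u} where
  Flag := G.Flag ⊕ (Bool × Bool)
  finite := by have := G.finite; infer_instance
  com
    | .inl x => .inl (G.com x)
    | .inr (i, h) => .inr (i, !h)
  ver
    | .inl x =>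
      if x = a then .inr (false, false)
      else if x = G.ver a then .inr (false, true)
      else if x = b then .inr (true, false)
      else if x = G.ver b then .inr (true, true)
      else .inl (G.ver x)
    | .inr (false, false) => .inl a
    | .inr (false, true) => .inl (G.ver a)
    | .inr (true, false) => .inl b
    | .inr (true, true) => .inl (G.ver b)
  edg
    | .inl x => .inl (G.edg x)
    | .inr (i, h) => .inr (!i, !h)
  com_com := by
    rintro (x | ⟨i, h⟩) <;> simp [G.com_com]
  ver_ver := by
    have h1 := G.ver_ver
    have h2 := G.ver_ne
    rintro (x | ⟨_ | _, _ | _⟩) <;> grind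
  edg_edg := by
    rintro (x | ⟨i, h⟩) <;> simp [G.edg_edg]
  com_ne := by
    rintro (x | ⟨i, h⟩) <;> simp [G.com_ne]
  ver_ne := by
    have h2 := G.ver_ne
    rintro (x | ⟨_ | _, _ | _⟩) <;> grind
  edg_ne := by
    rintro (x | ⟨i, h⟩) <;> simp [G.edg_ne]
  com_edg := by
    rintro (x | ⟨i, h⟩) <;> simp [G.com_edg]
  com_edg_ne := by
    rintro (x | ⟨i, h⟩) <;> simp [G.com_edg_ne]
  isolated := G.isolated

/-- The vertex line segments entered at `a` and at `b` lie on the boundary of one vertex, are both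
traversed from `a` to `ver a` and from `b` to `ver b` when going round it in one direction, and at
least one of the two arcs of the boundary between them contains an even number of common line
segments. -/
def EvenlySeparated (a b : G.Flag) : Prop :=
  ∃ n m : ℕ, FirstHit G.nextVertexSegment a b n ∧ FirstHit G.nextVertexSegment b a m ∧
    (Even n ∨ Even m)

/-- Splitting of a vertex: put consistent marking arrows of a new edge on the vertex line segments
entered at `a` and at `b`, and contract the new edge. -/
noncomputable def split (a b : G.Flag) (hab : a ≠ b) (hab' : G.ver a ≠ b) : RibbonGraph.{u} :=
  (G.addEdge a b hab hab').contract (Sum.inr (false, false))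

end Basic

/-- One operation in the formation of Eulerian minors. -/
inductive EulerianStep : RibbonGraph.{u} → RibbonGraph.{u} → Prop
  | contract (G : RibbonGraph.{u}) (x : G.Flag) (hx : G.ProperContraction x) :
      EulerianStep G (G.contract x)
  | deleteComponent (G : RibbonGraph.{u}) (x : G.Flag) :
      EulerianStep G (G.deleteComponent x)
  | deleteIsolated (G : RibbonGraph.{u}) (hG : G.isolated ≠ 0) :
      EulerianStep G G.deleteIsolated
  | split (G : RibbonGraph.{u}) (a b : G.Flag) (hab : a ≠ b) (hab' : G.ver a ≠ b)
      (h : G.EvenlySeparated a b) :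
      EulerianStep G (G.split a b hab hab')

/-- `H` is an Eulerian minor of `G`: it arises from `G` by a finite (possibly empty) sequence of
proper edge contractions, component deletions and evenly splitting vertices. -/
def EulerianMinor (G H : RibbonGraph.{u}) : Prop :=
  Relation.ReflTransGen EulerianStep G H

/-- `G` contains an Eulerian minor equivalent to `K`. -/
def HasEulerianMinor (G : RibbonGraph.{u}) (K : RibbonGraph.{v}) : Prop :=
  ∃ H : RibbonGraph.{u}, EulerianMinor G H ∧ H.Equivalent K

/-- The bouquet with one orientable loop. The flag `(i, h)` is the tail (`h = false`) or head
(`h = true`) of the arrow `i`; the order round the vertex is tail, head, tail, head. -/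
def B1 : RibbonGraph.{0} where
  Flag := Bool × Bool
  finite := inferInstance
  com x := (x.1, !x.2)
  ver x := (!x.1, !x.2)
  edg x := (!x.1, !x.2)
  com_com := by decide
  ver_ver := by decide
  edg_edg := by decide
  com_ne := by decide
  ver_ne := by decide
  edg_ne := by decide
  com_edg := by decide
  com_edg_ne := by decide
  isolated := 0

/-- The bouquet with one non-orientable loop. The flag `(i, h)` is the tail (`h = false`) or head
(`h = true`) of the arrow `i`; the order round the vertex is tail, head, head, tail. -/
def B1bar : RibbonGraph.{0} where
  Flag := Bool × Bool
  finite := inferInstance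
  com x := (x.1, !x.2)
  ver x := (!x.1, x.2)
  edg x := (!x.1, !x.2)
  com_com := by decide
  ver_ver := by decide
  edg_edg := by decide
  com_ne := by decide
  ver_ne := by decide
  edg_ne := by decide
  com_edg := by decide
  com_edg_ne := by decide
  isolated := 0

/-- The bouquet with three orientable loops whose ends lie in the cyclic order `1, 2, 3, 1, 2, 3`
round the vertex. The flag `(k, h)` is the tail (`h = false`) or head (`h = true`) of the `k`-th of
six arrows round the vertex, which all point in the same direction; the arrows `k` and `k + 3`
have the same label. -/
def B3 : RibbonGraph.{0} where
  Flag := Fin 6 × Bool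
  finite := inferInstance
  com x := (x.1, !x.2)
  ver x := (if x.2 then x.1 + 1 else x.1 - 1, !x.2)
  edg x := (x.1 + 3, !x.2)
  com_com := by decide
  ver_ver := by decide
  edg_edg := by decide
  com_ne := by decide
  ver_ne := by decide
  edg_ne := by decide
  com_edg := by decide
  com_edg_ne := by decide
  isolated := 0

/-- `B3` with one edge deleted (any two of its edges are related by a symmetry). -/
noncomputable def B3_sub_e : RibbonGraph.{0} := B3.deleteEdge ((0 : Fin 6), false)

end RibbonGraph

namespace RibbonGraph

/-! A checkerboard colouring amounts to a two-colouring of the flags that is constant along vertex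
and edge line segments and changes across every common line segment. Contraction does not change the
boundary components, and evenly separated vertex line segments have equal colours, so colourings
survive Eulerian steps. The three obstructions have no colouring, which gives one direction.

The converse is an induction on the number of flags. Let `G` be uncolourable.

If some vertex has odd degree, one end of an edge can be split off it evenly, leaving a vertex of
degree one. If the other end of that edge lies at an odd vertex, it can be split off too (unless
that vertex already has degree one), and `B1.dual` appears as a component. If it lies at an even
vertex, contracting the edge is proper and, by parity, leaves an uncolourable graph
(`hasObstruction_of_ver_eq_com`).

If all degrees are even, the flags can be coloured alternately round each vertex by some `ℓ`, and
only edges with `ℓ (edg x) ≠ ℓ x`, the bad ones, keep `ℓ` from being a checkerboard colouring. A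
non-loop can be contracted: if `κ` colours the contraction, then parity of `κ xor ℓ` at the two ends
shows that `κ` colours `G` (`hasObstruction_of_nonloop`). If all edges are loops, two consecutive
common line segments are split off from a vertex. Either this yields an obstruction, or the result
is colourable; in the latter case a loop at that vertex with just one end in the pair is bad, and
every bad loop there is of this kind (`crossing`). Shifting the pair round the vertex of a bad loop
pins that vertex down: it has two ends and forms `B1bar`, or four and forms `B3_sub_e`. -/

theorem natCard_lt_of_injective_of_notMem {α β : Type*} [Finite β] {f : α → β}
    (hf : Function.Injective f) {b : β} (hb : b ∉ Set.range f) : Nat.card α < Nat.card β := by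
  have := Finite.of_injective f hf
  cases nonempty_fintype α
  cases nonempty_fintype β
  simpa only [Nat.card_eq_fintype_card] using Fintype.card_lt_of_injective_of_notMem f hf hb

/-! ### Colourings of flags, and of contractions -/

section Colouring

variable (G : RibbonGraph.{u})

/-- A colouring of the flags that witnesses checkerboard colourability. -/
structure IsColouring (κ : G.Flag → Bool) : Prop where
  ver : ∀ y, κ (G.ver y) = κ y
  edg : ∀ y, κ (G.edg y) = κ y
  com : ∀ y, κ (G.com y) = !κ y

theorem checkerboardColourable_iff : G.CheckerboardColourable ↔ ∃ κ, G.IsColouring κ := by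
  constructor
  · rintro ⟨κ, hκ⟩
    refine ⟨fun y => κ (G.boundaryOf y), fun y => ?_, fun y => ?_, fun y => ?_⟩
    · exact congrArg κ (congrArg Sum.inl (Quotient.sound
        (G.boundarySetoid.symm (.rel _ _ (.inr rfl)))))
    · exact congrArg κ (congrArg Sum.inl (Quotient.sound
        (G.boundarySetoid.symm (.rel _ _ (.inl rfl)))))
    · have := hκ y
      revert this
      cases κ (G.boundaryOf y) <;> cases κ (G.boundaryOf (G.com y)) <;> simp
  · rintro ⟨κ, hκ⟩
    have key : ∀ x y, G.boundarySetoid x y → κ x = κ y := by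
      intro x y h
      induction h with
      | rel x y h => rcases h with rfl | rfl <;> simp [hκ.ver, hκ.edg]
      | refl => rfl
      | symm _ _ _ ih => exact ih.symm
      | trans _ _ _ _ _ ih1 ih2 => exact ih1.trans ih2
    -- Boundary circles of isolated vertices meet no edge, so any colour will do.
    refine ⟨Sum.elim (Quotient.lift κ key) fun _ => false, fun x => ?_⟩
    change κ x ≠ κ (G.com x)
    rw [hκ.com]
    cases κ x <;> simp

theorem Equivalent.checkerboardColourable {G : RibbonGraph.{u}} {H : RibbonGraph.{v}}
    (h : G.Equivalent H) (hG : G.CheckerboardColourable) : H.CheckerboardColourable := by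
  obtain ⟨-, φ, hφ⟩ := h
  obtain ⟨κ, hκ⟩ := G.checkerboardColourable_iff.1 hG
  refine H.checkerboardColourable_iff.2 ⟨κ ∘ φ.symm, fun y => ?_, fun y => ?_, fun y => ?_⟩ <;>
    obtain ⟨x, rfl⟩ := φ.surjective y <;> simp only [Function.comp_apply]
  · rw [← (hφ x).2.1]; simp [hκ.ver]
  · rw [← (hφ x).2.2]; simp [hκ.edg]
  · rw [← (hφ x).1]; simp [hκ.com]

theorem com_mem_edgeFlags_iff {x y : G.Flag} : G.com y ∈ G.edgeFlags x ↔ y ∈ G.edgeFlags x :=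
  ⟨fun h => by simpa [G.com_com] using G.com_mem_edgeFlags h, G.com_mem_edgeFlags⟩

theorem edg_mem_edgeFlags_iff {x y : G.Flag} : G.edg y ∈ G.edgeFlags x ↔ y ∈ G.edgeFlags x :=
  ⟨fun h => by simpa [G.edg_edg] using G.edg_mem_edgeFlags h, G.edg_mem_edgeFlags⟩

/-- The partial dual with respect to a single edge. -/
noncomputable abbrev edgeDual (x : G.Flag) : RibbonGraph.{u} :=
  G.partialDual (G.edgeFlags x) fun _ h => ⟨G.com_mem_edgeFlags h, G.edg_mem_edgeFlags h⟩

theorem self_mem_edgeFlags (x : G.Flag) : x ∈ G.edgeFlags x := .inl rfl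

theorem edgeDual_com {x z : G.Flag} (hz : z ∈ G.edgeFlags x) :
    (show G.Flag from (G.edgeDual x).com z) = G.edg z :=
  if_pos hz

theorem edgeDual_edg {x z : G.Flag} (hz : z ∈ G.edgeFlags x) :
    (show G.Flag from (G.edgeDual x).edg z) = G.com z :=
  if_pos hz

theorem edgeFlags_edgeDual (x : G.Flag) :
    (show Set G.Flag from (G.edgeDual x).edgeFlags x) = G.edgeFlags x := by
  have h0 := G.self_mem_edgeFlags x
  have h1 := G.com_mem_edgeFlags h0
  ext y
  have e : (show Set G.Flag from (G.edgeDual x).edgeFlags x) =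
      {x, G.edg x, G.com x, G.edg (G.com x)} := by
    rw [← G.edgeDual_com h1, ← G.edgeDual_edg h0, ← G.edgeDual_com h0]
    rfl
  rw [e, edgeFlags, G.com_edg]
  simp only [Set.mem_insert_iff, Set.mem_singleton_iff]
  tauto

open scoped Classical in
/-- The other end of the vertex line segment that starts at the flag `y` once the edge of `x` has
been contracted. -/
noncomputable def verContract (x y : G.Flag) : G.Flag :=
  if G.ver y ∉ G.edgeFlags x then G.ver y
  else if G.ver (G.edg (G.ver y)) ∉ G.edgeFlags x then G.ver (G.edg (G.ver y))
  else G.ver (G.edg (G.ver (G.edg (G.ver y))))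

theorem verDelete_edgeDual (x y : G.Flag) :
    (show G.Flag from (G.edgeDual x).verDelete x y) = G.verContract x y := by
  classical
  obtain ⟨S, hS⟩ : ∃ S : Set G.Flag, S = (G.edgeDual x).edgeFlags x := ⟨_, rfl⟩
  obtain ⟨c, hc⟩ : ∃ c : G.Flag → G.Flag, c = (G.edgeDual x).com := ⟨_, rfl⟩
  have hS' : S = G.edgeFlags x := hS.trans (G.edgeFlags_edgeDual x)
  have hc' : ∀ z ∈ G.edgeFlags x, c z = G.edg z := fun z hz => by
    rw [hc]; exact G.edgeDual_com hz
  have e : (show G.Flag from (G.edgeDual x).verDelete x y) =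
      if G.ver y ∉ S then G.ver y
      else if G.ver (c (G.ver y)) ∉ S then G.ver (c (G.ver y))
      else G.ver (c (G.ver (c (G.ver y)))) := by
    subst hS hc
    unfold verDelete
    congr
  rw [e, hS', verContract]
  by_cases h1 : G.ver y ∈ G.edgeFlags x
  · rw [hc' _ h1]
    by_cases h2 : G.ver (G.edg (G.ver y)) ∈ G.edgeFlags x
    · rw [hc' _ h2]
    · simp only [h2, not_false_eq_true, if_true]
  · simp only [h1, not_false_eq_true, if_true]

/-- The flags of a contraction, as flags of the ribbon graph. -/
noncomputable def ofContract (x : G.Flag) (y : (G.contract x).Flag) : G.Flag := y.1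

theorem ofContract_injective (x : G.Flag) : Function.Injective (G.ofContract x) :=
  fun _ _ h => Subtype.ext h

theorem ofContract_notMem (x : G.Flag) (y : (G.contract x).Flag) :
    G.ofContract x y ∉ G.edgeFlags x := by
  have := y.2
  rwa [← G.edgeFlags_edgeDual x]

theorem exists_ofContract {x y : G.Flag} (hy : y ∉ G.edgeFlags x) :
    ∃ z, G.ofContract x z = y :=
  ⟨⟨y, by rwa [← G.edgeFlags_edgeDual x] at hy⟩, rfl⟩

theorem ofContract_com (x : G.Flag) (y : (G.contract x).Flag) :
    G.ofContract x ((G.contract x).com y) = G.com (G.ofContract x y) :=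
  if_neg (G.ofContract_notMem x y)

theorem ofContract_edg (x : G.Flag) (y : (G.contract x).Flag) :
    G.ofContract x ((G.contract x).edg y) = G.edg (G.ofContract x y) :=
  if_neg (G.ofContract_notMem x y)

theorem ofContract_ver (x : G.Flag) (y : (G.contract x).Flag) :
    G.ofContract x ((G.contract x).ver y) = G.verContract x (G.ofContract x y) :=
  G.verDelete_edgeDual x y.1

theorem card_contract_lt (x : G.Flag) : Nat.card (G.contract x).Flag < Nat.card G.Flag := by
  have := G.finite
  refine natCard_lt_of_injective_of_notMem (G.ofContract_injective x) (b := x) ?_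
  rintro ⟨y, hy⟩
  have := G.ofContract_notMem x y
  rw [hy] at this
  exact this (G.self_mem_edgeFlags x)

/-- A colouring of `G / e`, extended to the flags of `e`. -/
structure IsContractColouring (x : G.Flag) (κ : G.Flag → Bool) : Prop where
  ver : ∀ y, κ (G.ver y) = κ y
  edg : ∀ y, κ (G.edg y) = κ y
  com : ∀ y, y ∉ G.edgeFlags x → κ (G.com y) = !κ y

/-- A vertex line segment of `G / e` crosses `e` along edge line segments, so it follows a boundary
component of `G`. Contraction thus only drops the condition that the colour changes across the
common line segments of `e`. -/
theorem contract_checkerboardColourable_iff (x : G.Flag) :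
    (G.contract x).CheckerboardColourable ↔ ∃ κ, G.IsContractColouring x κ := by
  rw [checkerboardColourable_iff]
  constructor
  · rintro ⟨κ, hκ⟩
    classical
    obtain ⟨κ', hκ'⟩ : ∃ κ' : G.Flag → Bool, ∀ y, κ' (G.ofContract x y) = κ y := by
      have := (G.ofContract_injective x).extend_apply κ (fun _ => false)
      exact ⟨_, this⟩
    have c1 : ∀ y, y ∉ G.edgeFlags x → κ' (G.com y) = !κ' y := by
      intro y h
      obtain ⟨z, rfl⟩ := G.exists_ofContract h
      rw [← ofContract_com, hκ', hκ', hκ.com]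
    have c2 : ∀ y, y ∉ G.edgeFlags x → κ' (G.edg y) = κ' y := by
      intro y h
      obtain ⟨z, rfl⟩ := G.exists_ofContract h
      rw [← ofContract_edg, hκ', hκ', hκ.edg]
    have c3 : ∀ y, y ∉ G.edgeFlags x → κ' (G.verContract x y) = κ' y := by
      intro y h
      obtain ⟨z, rfl⟩ := G.exists_ofContract h
      rw [← ofContract_ver, hκ', hκ', hκ.ver]
    have c4 : ∀ y, y ∉ G.edgeFlags x → G.verContract x y ∉ G.edgeFlags x := by
      intro y h
      obtain ⟨z, rfl⟩ := G.exists_ofContract h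
      rw [← ofContract_ver]
      exact G.ofContract_notMem x _
    clear hκ' hκ
    have e1 := G.edg_edg
    have e2 := G.ver_ver
    have e3 : ∀ z, G.edg z ∈ G.edgeFlags x ↔ z ∈ G.edgeFlags x := fun _ => G.edg_mem_edgeFlags_iff
    have key : ∀ z w, z ∈ G.edgeFlags x → w ∈ G.edgeFlags x → w ≠ z → w ≠ G.edg z →
      ∀ t ∈ G.edgeFlags x, t = z ∨ t = G.edg z ∨ t = w ∨ t = G.edg w := by
      intro z w hz hw h1 h2 t ht
      have := G.com_edg
      simp only [edgeFlags, Set.mem_insert_iff, Set.mem_singleton_iff] at hz hw ht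
      grind
    have e4 := G.ver_ne
    have e5 := G.edg_ne
    -- on a flag of the edge, take the colour of the flag at which the boundary leaves the edge
    obtain ⟨κ₀, hκ₀⟩ : ∃ κ₀ : G.Flag → Option Bool, ∀ y, κ₀ y =
      if G.ver y ∉ G.edgeFlags x then some (κ' (G.ver y))
      else if G.ver (G.edg (G.ver y)) ∉ G.edgeFlags x then some (κ' (G.ver (G.edg (G.ver y))))
      else none := ⟨_, fun _ => rfl⟩
    -- A boundary arc that leaves `e` at both ends is part of one vertex line segment of the
    -- contraction, so its two exits have the same colour.
    have agree : ∀ y ∈ G.edgeFlags x, ∀ a b, κ₀ y = some a → κ₀ (G.edg y) = some b → a = b := by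
      intro y hy a b ha hb
      have h1 := c3 (G.ver y)
      have h2 := c3 (G.ver (G.edg y))
      rw [verContract, e2] at h1 h2
      rw [hκ₀] at ha hb
      clear hκ₀ c1 c2 c3 c4
      by_cases m1 : G.ver y ∈ G.edgeFlags x
      · by_cases m2 : G.ver (G.edg y) ∈ G.edgeFlags x
        · by_cases m3 : G.ver (G.edg (G.ver y)) ∈ G.edgeFlags x
          · simp [m1, m3] at ha
          · have := key y (G.ver y) hy m1 (e4 y) (by grind) _ m2
            grind
        · have hy' := (e3 y).2 hy
          simp only [m1, m2, hy', e1, not_true, if_false, not_false_eq_true, if_true] at ha hb h2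
          grind
      · simp only [m1, hy, not_true, if_false, not_false_eq_true, if_true] at ha h1
        grind
    -- The default `false` is reached only on boundary components all of whose flags belong to `e`;
    -- no condition ties them to other components.
    obtain ⟨f, hf⟩ : ∃ f : G.Flag → Bool, ∀ y,
      f y = if y ∉ G.edgeFlags x then κ' y else (κ₀ y <|> κ₀ (G.edg y)).getD false :=
      ⟨_, fun _ => rfl⟩
    have f1 : ∀ y, y ∉ G.edgeFlags x → f y = κ' y := fun y h => by rw [hf, if_pos h]
    have f2 : ∀ y, y ∈ G.edgeFlags x → f y = (κ₀ y <|> κ₀ (G.edg y)).getD false :=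
      fun y h => by rw [hf, if_neg (not_not.2 h)]
    have edg : ∀ y, f (G.edg y) = f y := by
      intro y
      by_cases hy : y ∈ G.edgeFlags x
      · have := agree y hy
        rw [f2 _ hy, f2 _ ((e3 y).2 hy), e1]
        revert this
        cases κ₀ y <;> cases κ₀ (G.edg y) <;> simp
        exact Eq.symm
      · rw [f1 _ hy, f1 _ (mt (e3 y).1 hy), c2 _ hy]
    have ver1 : ∀ y, y ∈ G.edgeFlags x → G.ver y ∉ G.edgeFlags x → f (G.ver y) = f y := by
      intro y hy h
      rw [f1 _ h, f2 _ hy, hκ₀ y, if_pos h]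
      rfl
    have ver : ∀ y, f (G.ver y) = f y := by
      intro y
      by_cases hy : y ∈ G.edgeFlags x <;> by_cases h : G.ver y ∈ G.edgeFlags x
      · by_cases h1 : G.ver y = G.edg y
        · rw [h1, edg]
        by_cases h2 : G.ver (G.edg (G.ver y)) ∈ G.edgeFlags x
        · have h3 : G.ver (G.edg (G.ver y)) = G.edg y := by grind
          have n1 : κ₀ y = none := by grind
          have n2 : κ₀ (G.edg y) = none := by grind
          have n3 : κ₀ (G.ver y) = none := by grind
          have n4 : κ₀ (G.edg (G.ver y)) = none := by grind
          rw [f2 _ hy, f2 _ h, n1, n2, n3, n4]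
        · rw [← edg (G.ver y), f2 _ ((e3 _).2 h), f2 _ hy, hκ₀ y, hκ₀ (G.edg (G.ver y))]
          simp [h, h2]
      · exact ver1 y hy h
      · rw [← ver1 _ h (by rwa [e2]), e2]
      · have := c3 y hy
        rw [verContract, if_pos h] at this
        rw [f1 _ hy, f1 _ h, this]
    refine ⟨f, ver, edg, ?_⟩
    · intro y h
      have h' : G.com y ∉ G.edgeFlags x := mt G.com_mem_edgeFlags_iff.1 h
      rw [f1 _ h, f1 _ h', c1 _ h]
  · rintro ⟨κ, hκ⟩
    refine ⟨fun y => κ (G.ofContract x y), fun y => ?_, fun y => ?_, fun y => ?_⟩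
    · simp only [ofContract_ver, verContract]
      split_ifs <;> simp only [hκ.ver, hκ.edg]
    · simp only [ofContract_edg, hκ.edg]
    · simp only [ofContract_com, hκ.com _ (G.ofContract_notMem x y)]

end Colouring

/-! ### Vertex splitting as a change of `ver` on the same flags -/

section Splitting

variable (G : RibbonGraph.{u})

open scoped Classical in
/-- The vertex line segments after a vertex has been split. -/
noncomputable def verSplit (a b z : G.Flag) : G.Flag :=
  if z = a then G.ver b else if z = G.ver b then a
  else if z = b then G.ver a else if z = G.ver a then b else G.ver z

variable (a b : G.Flag) (hab : a ≠ b) (hab' : G.ver a ≠ b)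

theorem inl_notMem_edgeFlags (z : G.Flag) : (Sum.inl z : (G.addEdge a b hab hab').Flag) ∉
    (G.addEdge a b hab hab').edgeFlags (Sum.inr (false, false)) := by
  rintro (h | h | h | h) <;> cases h

theorem inr_mem_edgeFlags (p : Bool × Bool) : (Sum.inr p : (G.addEdge a b hab hab').Flag) ∈
    (G.addEdge a b hab hab').edgeFlags (Sum.inr (false, false)) := by
  obtain ⟨_ | _, _ | _⟩ := p
  exacts [.inl rfl, .inr (.inl rfl), .inr (.inr (.inr rfl)), .inr (.inr (.inl rfl))]

theorem verContract_of_notMem {x y : G.Flag} (h : G.ver y ∉ G.edgeFlags x) :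
    G.verContract x y = G.ver y :=
  if_pos h

theorem verContract_of_mem {x y z : G.Flag} (hz : G.ver y = z) (h : z ∈ G.edgeFlags x)
    (h' : G.ver (G.edg z) ∉ G.edgeFlags x) : G.verContract x y = G.ver (G.edg z) := by
  subst hz
  exact (if_neg (not_not.2 h)).trans (if_pos h')

theorem verContract_addEdge (z : G.Flag) :
    (G.addEdge a b hab hab').verContract (Sum.inr (false, false)) (Sum.inl z) =
      Sum.inl (G.verSplit a b z) := by
  have h0 := G.inl_notMem_edgeFlags a b hab hab'
  have h1 := G.inr_mem_edgeFlags a b hab hab'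
  have n1 := G.ver_ne
  have n2 := G.ver_ver
  have n3 : G.ver b ≠ a := by grind
  have n4 : G.ver a ≠ G.ver b := by grind
  -- `(!p.1, !p.2)` is `edg` of the new flag `p`: the contraction crosses the new edge along an edge
  -- line segment.
  have key : ∀ p w, (G.addEdge a b hab hab').ver (Sum.inl z) = Sum.inr p →
      (G.addEdge a b hab hab').ver (Sum.inr (!p.1, !p.2)) = Sum.inl w →
      (G.addEdge a b hab hab').verContract (Sum.inr (false, false)) (Sum.inl z) = Sum.inl w := by
    intro p w h h'
    refine (verContract_of_mem _ h (h1 _) ?_).trans h'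
    exact fun hm => h0 w (h' ▸ hm)
  by_cases e1 : z = a
  · rw [key (false, false) (G.ver b) (if_pos e1) rfl, verSplit, if_pos e1]
  by_cases e2 : z = G.ver a
  · rw [key (false, true) b ((if_neg e1).trans (if_pos e2)) rfl, verSplit, if_neg e1,
      if_neg (e2 ▸ n4), if_neg (e2 ▸ hab'), if_pos e2]
  by_cases e3 : z = b
  · rw [key (true, false) (G.ver a) ((if_neg e1).trans ((if_neg e2).trans (if_pos e3))) rfl,
      verSplit, if_neg e1, if_neg (e3 ▸ (n1 b).symm), if_pos e3]
  by_cases e4 : z = G.ver b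
  · rw [key (true, true) a
      ((if_neg e1).trans ((if_neg e2).trans ((if_neg e3).trans (if_pos e4)))) rfl,
      verSplit, if_neg e1, if_pos e4]
  have e : (G.addEdge a b hab hab').ver (Sum.inl z) = Sum.inl (G.ver z) :=
    (if_neg e1).trans ((if_neg e2).trans ((if_neg e3).trans (if_neg e4)))
  refine (verContract_of_notMem _ fun hm => h0 _ (e ▸ hm)).trans (e.trans ?_)
  rw [verSplit, if_neg e1, if_neg e4, if_neg e3, if_neg e2]

/-- The flags of a split ribbon graph. -/
theorem exists_equiv_split : ∃ φ : G.Flag ≃ (G.split a b hab hab').Flag, ∀ z,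
    (G.split a b hab hab').com (φ z) = φ (G.com z) ∧
    (G.split a b hab hab').ver (φ z) = φ (G.verSplit a b z) ∧
    (G.split a b hab hab').edg (φ z) = φ (G.edg z) := by
  obtain ⟨o, ho⟩ : ∃ o, o = (G.addEdge a b hab hab').ofContract (Sum.inr (false, false)) :=
    ⟨_, rfl⟩
  have inj : Function.Injective o := ho ▸ ofContract_injective _ _
  have hφ : ∀ z, ∃ y, o y = Sum.inl z := fun z =>
    ho ▸ exists_ofContract _ (G.inl_notMem_edgeFlags a b hab hab' z)
  choose φ hφ using hφ
  have bij : Function.Bijective φ := by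
    refine ⟨fun x y h => ?_, fun y => ?_⟩
    · have := hφ x
      rw [h, hφ y] at this
      exact (Sum.inl.inj this).symm
    · rcases h : o y with z | p
      · exact ⟨z, inj (by rw [hφ, h])⟩
      · refine absurd (G.inr_mem_edgeFlags a b hab hab' p) ?_
        rw [← h, ho]
        exact ofContract_notMem _ _ _
  refine ⟨Equiv.ofBijective φ bij, fun z => ⟨inj ?_, inj ?_, inj ?_⟩⟩
  · refine Eq.trans ?_ (hφ _).symm
    have := ofContract_com (G.addEdge a b hab hab') (Sum.inr (false, false)) (φ z)
    rw [← ho] at this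
    refine this.trans ?_
    rw [hφ]
    rfl
  · refine Eq.trans ?_ (hφ _).symm
    have := ofContract_ver (G.addEdge a b hab hab') (Sum.inr (false, false)) (φ z)
    rw [← ho] at this
    refine this.trans ?_
    rw [hφ, verContract_addEdge]
  · refine Eq.trans ?_ (hφ _).symm
    have := ofContract_edg (G.addEdge a b hab hab') (Sum.inr (false, false)) (φ z)
    rw [← ho] at this
    refine this.trans ?_
    rw [hφ]
    rfl

end Splitting

/-! ### Eulerian steps preserve colourability; the obstructions are not colourable -/

section Preservation

variable {G : RibbonGraph.{u}}

/-- Each step crosses exactly one common line segment and so changes the colour once. -/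
theorem iterate_nextVertexSegment_colour {κ : G.Flag → Bool} (hv : ∀ y, κ (G.ver y) = κ y)
    (hc : ∀ y, κ (G.com y) = !κ y) (n : ℕ) (y : G.Flag) :
    κ (G.nextVertexSegment^[n] y) = (κ y ^^ decide (Odd n)) := by
  induction n with
  | zero => simp
  | succ n ih =>
    rw [Function.iterate_succ_apply', nextVertexSegment, hc, hv, ih]
    by_cases h : Odd n <;> simp [h, Nat.odd_add_one]

theorem EvenlySeparated.colour_eq {κ : G.Flag → Bool} (hv : ∀ y, κ (G.ver y) = κ y)
    (hc : ∀ y, κ (G.com y) = !κ y) {a b : G.Flag} (h : G.EvenlySeparated a b) : κ a = κ b := by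
  obtain ⟨n, m, h1, h2, h | h⟩ := h
  · rw [← h1.1, iterate_nextVertexSegment_colour hv hc]
    simp [Nat.not_odd_iff_even.2 h]
  · rw [← h2.1, iterate_nextVertexSegment_colour hv hc]
    simp [Nat.not_odd_iff_even.2 h]

theorem verSplit_colour {κ : G.Flag → Bool} {a b : G.Flag} (hv : ∀ y, κ (G.ver y) = κ y)
    (h : κ a = κ b) (z : G.Flag) : κ (G.verSplit a b z) = κ z := by
  unfold verSplit
  split_ifs with h1 h2 h3 h4 <;> simp [*]

theorem EulerianStep.checkerboardColourable {G H : RibbonGraph.{u}} (h : EulerianStep G H)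
    (hG : G.CheckerboardColourable) : H.CheckerboardColourable := by
  obtain ⟨κ, hκ⟩ := G.checkerboardColourable_iff.1 hG
  cases h with
  | contract x hx =>
    exact (G.contract_checkerboardColourable_iff x).2 ⟨κ, hκ.ver, hκ.edg, fun y _ => hκ.com y⟩
  | deleteComponent x =>
    exact (checkerboardColourable_iff _).2 ⟨fun y => κ y.1, fun y => hκ.ver y.1,
      fun y => hκ.edg y.1, fun y => hκ.com y.1⟩
  | deleteIsolated hG =>
    exact (checkerboardColourable_iff _).2 ⟨κ, hκ.ver, hκ.edg, hκ.com⟩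
  | split a b hab hab' h =>
    obtain ⟨φ, hφ⟩ := G.exists_equiv_split a b hab hab'
    refine (checkerboardColourable_iff _).2 ⟨κ ∘ φ.symm, fun y => ?_, fun y => ?_, fun y => ?_⟩ <;>
      obtain ⟨x, rfl⟩ := φ.surjective y <;> simp only [Function.comp_apply, hφ, φ.symm_apply_apply]
    · exact verSplit_colour hκ.ver (h.colour_eq hκ.ver hκ.com) x
    · exact hκ.edg x
    · exact hκ.com x

theorem not_checkerboardColourable_of_hasEulerianMinor {G : RibbonGraph.{u}} {K : RibbonGraph.{v}}
    (hK : ¬ K.CheckerboardColourable) (h : G.HasEulerianMinor K) :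
    ¬ G.CheckerboardColourable := by
  obtain ⟨H, hH, e⟩ := h
  intro hG
  refine hK (e.checkerboardColourable ?_)
  clear e
  induction hH with
  | refl => exact hG
  | tail _ h ih => exact h.checkerboardColourable ih

theorem not_checkerboardColourable_B1_dual : ¬ B1.dual.CheckerboardColourable := by
  rw [checkerboardColourable_iff]
  rintro ⟨κ, hκ⟩
  have e : B1.dual.com ((false, false) : Bool × Bool) = ((true, true) : Bool × Bool) :=
    if_pos trivial
  have h1 : κ (true, true) = !κ (false, false) := (congrArg κ e).symm.trans (hκ.com _)
  have h2 : κ (true, true) = κ (false, false) := hκ.ver ((false, false) : Bool × Bool)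
  revert h1
  rw [h2]
  cases κ (false, false) <;> simp

theorem not_checkerboardColourable_B1bar : ¬ B1bar.CheckerboardColourable := by
  rw [checkerboardColourable_iff]
  rintro ⟨κ, hκ⟩
  have h1 := hκ.com ((false, false) : Bool × Bool)
  have h2 := hκ.ver ((false, false) : Bool × Bool)
  have h3 := hκ.edg ((true, false) : Bool × Bool)
  have h4 : κ (false, true) = κ (true, false) := h3
  have h5 : κ (true, false) = κ (false, false) := h2
  have h6 : κ (false, true) = !κ (false, false) := h1
  rw [h4, h5] at h6
  revert h6
  cases κ (false, false) <;> simp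

end Preservation

/-! ### Obstructions as components -/

section Components

variable {G : RibbonGraph.{u}}

theorem mem_iff_of_eqvGen {α : Type*} {r : α → α → Prop} {S : Set α}
    (h : ∀ x y, r x y → (x ∈ S ↔ y ∈ S)) {x y : α} (hxy : Relation.EqvGen r x y) :
    x ∈ S ↔ y ∈ S := by
  induction hxy with
  | rel x y hr => exact h x y hr
  | refl => rfl
  | symm _ _ _ ih => exact ih.symm
  | trans _ _ _ _ _ ih1 ih2 => exact ih1.trans ih2

theorem mem_iff_of_involutive {α : Type*} {f : α → α} (hf : ∀ x, f (f x) = x) {S : Set α}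
    (h : ∀ x ∈ S, f x ∈ S) (x : α) : x ∈ S ↔ f x ∈ S :=
  ⟨h x, fun hx => hf x ▸ h _ hx⟩

theorem mem_iff_of_componentSetoid {S : Set G.Flag} (hc : ∀ x ∈ S, G.com x ∈ S)
    (hv : ∀ x ∈ S, G.ver x ∈ S) (he : ∀ x ∈ S, G.edg x ∈ S) {x y : G.Flag}
    (h : G.componentSetoid x y) : x ∈ S ↔ y ∈ S := by
  refine mem_iff_of_eqvGen ?_ h
  rintro x y (rfl | rfl | rfl)
  exacts [mem_iff_of_involutive G.com_com hc x, mem_iff_of_involutive G.ver_ver hv x,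
    mem_iff_of_involutive G.edg_edg he x]

theorem mem_iff_of_vertexSetoid {S : Set G.Flag} (hc : ∀ x ∈ S, G.com x ∈ S)
    (hv : ∀ x ∈ S, G.ver x ∈ S) {x y : G.Flag} (h : G.vertexSetoid x y) : x ∈ S ↔ y ∈ S := by
  refine mem_iff_of_eqvGen ?_ h
  rintro x y (rfl | rfl)
  exacts [mem_iff_of_involutive G.com_com hc x, mem_iff_of_involutive G.ver_ver hv x]

theorem card_deleteComponent_lt (x : G.Flag) :
    Nat.card (G.deleteComponent x).Flag < Nat.card G.Flag := by
  have := G.finite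
  refine natCard_lt_of_injective_of_notMem (f := Subtype.val) Subtype.val_injective (b := x) ?_
  rintro ⟨y, hy⟩
  exact y.2 (by rw [hy])

theorem HasEulerianMinor.of_step {G H : RibbonGraph.{u}} {K : RibbonGraph.{v}}
    (h : EulerianStep G H) (hH : H.HasEulerianMinor K) : G.HasEulerianMinor K := by
  obtain ⟨L, hL, e⟩ := hH
  exact ⟨L, hL.head h, e⟩

theorem hasEulerianMinor_of_equiv {K : RibbonGraph.{v}} (hK : K.isolated = 0) (n : ℕ) :
    ∀ (G : RibbonGraph.{u}), G.isolated = n → ∀ φ : G.Flag ≃ K.Flag, (∀ x,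
      φ (G.com x) = K.com (φ x) ∧ φ (G.ver x) = K.ver (φ x) ∧ φ (G.edg x) = K.edg (φ x)) →
      G.HasEulerianMinor K := by
  induction n with
  | zero => exact fun G hG φ hφ => ⟨G, .refl, hG.trans hK.symm, φ, hφ⟩
  | succ n ih =>
    intro G hG φ hφ
    exact .of_step (.deleteIsolated G (by omega))
      (ih G.deleteIsolated (show G.isolated - 1 = n by omega) φ hφ)

/-- A ribbon graph contains any union of its components as an Eulerian minor. -/
theorem hasEulerianMinor_of_injective {K : RibbonGraph.{v}} (hK : K.isolated = 0) (n : ℕ) :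
    ∀ (G : RibbonGraph.{u}), Nat.card G.Flag = n → ∀ φ : K.Flag → G.Flag, φ.Injective →
      (∀ x, φ (K.com x) = G.com (φ x)) → (∀ x, φ (K.ver x) = G.ver (φ x)) →
      (∀ x, φ (K.edg x) = G.edg (φ x)) → G.HasEulerianMinor K := by
  induction n using Nat.strong_induction_on with
  | _ n ih =>
  intro G hG φ inj hc hv he
  by_cases sur : φ.Surjective
  · let ψ := Equiv.ofBijective φ ⟨inj, sur⟩
    refine hasEulerianMinor_of_equiv hK _ G rfl ψ.symm fun x => ?_
    obtain ⟨z, rfl⟩ := ψ.surjective x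
    refine ⟨?_, ?_, ?_⟩ <;> rw [ψ.symm_apply_eq, ψ.symm_apply_apply]
    exacts [(hc z).symm, (hv z).symm, (he z).symm]
  · obtain ⟨y, hy⟩ : ∃ y, y ∉ Set.range φ := by simpa [Function.Surjective] using sur
    -- The image of `φ` is closed under all three involutions, so the component of a flag outside it
    -- can be deleted without harm.
    have key : ∀ k, ¬ G.componentSetoid y (φ k) := by
      intro k hk
      refine hy ((mem_iff_of_componentSetoid ?_ ?_ ?_ hk).2 ⟨k, rfl⟩)
      · rintro _ ⟨z, rfl⟩; exact ⟨_, hc z⟩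
      · rintro _ ⟨z, rfl⟩; exact ⟨_, hv z⟩
      · rintro _ ⟨z, rfl⟩; exact ⟨_, he z⟩
    refine .of_step (.deleteComponent G y) (ih _ (hG ▸ card_deleteComponent_lt y) _ rfl
      (fun k => ⟨φ k, key k⟩) (fun a b h => inj (congrArg Subtype.val h)) ?_ ?_ ?_)
    · exact fun z => Subtype.ext (hc z)
    · exact fun z => Subtype.ext (hv z)
    · exact fun z => Subtype.ext (he z)

/-- A component with two vertices and one edge. -/
theorem hasEulerianMinor_B1_dual {x : G.Flag} (h1 : G.ver x = G.com x)
    (h2 : G.ver (G.edg x) = G.com (G.edg x)) : G.HasEulerianMinor B1.dual := by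
  have c1 := G.com_com
  have c2 := G.com_ne
  have c3 := G.edg_edg
  have c4 := G.edg_ne
  have c5 := G.com_edg
  have c6 := G.com_edg_ne
  have c7 := G.ver_ver
  have ec : ∀ p : Bool × Bool, B1.dual.com p = ((!p.1, !p.2) : Bool × Bool) :=
    fun p => if_pos trivial
  have ee : ∀ p : Bool × Bool, B1.dual.edg p = ((p.1, !p.2) : Bool × Bool) :=
    fun p => if_pos trivial
  let φ : Bool × Bool → G.Flag
    | (false, false) => x
    | (true, true) => G.com x
    | (false, true) => G.edg x
    | (true, false) => G.com (G.edg x)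
  refine hasEulerianMinor_of_injective (K := B1.dual) rfl _ G rfl φ ?_ ?_ ?_ ?_
  · rintro ⟨_ | _, _ | _⟩ ⟨_ | _, _ | _⟩ h <;> simp only [φ] at h <;> first | rfl | grind
  · intro p
    refine (congrArg φ (ec p)).trans ?_
    obtain ⟨_ | _, _ | _⟩ := p <;> simp [φ, c1]
  · rintro ⟨_ | _, _ | _⟩
    exacts [h1.symm, h2.symm, (congrArg G.ver h2).symm.trans (c7 _) |>.symm,
      (congrArg G.ver h1).symm.trans (c7 _) |>.symm]
  · intro p
    refine (congrArg φ (ee p)).trans ?_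
    obtain ⟨_ | _, _ | _⟩ := p <;> simp [φ, c3, c5]

/-- A component with one vertex and one non-orientable loop. -/
theorem hasEulerianMinor_B1bar {x : G.Flag} (h1 : G.ver x = G.com (G.edg x))
    (h2 : G.ver (G.com x) = G.edg x) : G.HasEulerianMinor B1bar := by
  have c1 := G.com_com
  have c2 := G.com_ne
  have c3 := G.edg_edg
  have c4 := G.edg_ne
  have c5 := G.com_edg
  have c6 := G.com_edg_ne
  have c7 := G.ver_ver
  let φ : Bool × Bool → G.Flag
    | (false, false) => x
    | (false, true) => G.com x
    | (true, true) => G.edg x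
    | (true, false) => G.com (G.edg x)
  refine hasEulerianMinor_of_injective (K := B1bar) rfl _ G rfl φ ?_ ?_ ?_ ?_
  · rintro ⟨_ | _, _ | _⟩ ⟨_ | _, _ | _⟩ h <;> simp only [φ] at h <;> first | rfl | grind
  · rintro ⟨_ | _, _ | _⟩ <;> simp [φ, B1bar, c1]
  · rintro ⟨_ | _, _ | _⟩
    exacts [h1.symm, h2.symm, (congrArg G.ver h1).symm.trans (c7 _) |>.symm,
      (congrArg G.ver h2).symm.trans (c7 _) |>.symm]
  · rintro ⟨_ | _, _ | _⟩ <;> simp [φ, B1bar, c3, c5]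

end Components

/-! ### The bouquet `B3_sub_e` -/

section Targets

theorem B3_mem_edgeFlags (p : Fin 6 × Bool) :
    p ∈ B3.edgeFlags ((0 : Fin 6), false) ↔ p.1 = 0 ∨ p.1 = 3 := by
  have : p ∈ B3.edgeFlags ((0 : Fin 6), false) ↔
      p = (0, false) ∨ p = (0, true) ∨ p = (3, true) ∨ p = (3, false) := Iff.rfl
  rw [this]
  clear this
  revert p
  decide

/-- The other end of a vertex line segment of `B3_sub_e`. -/
def verB3Sub (p : Fin 6 × Bool) : Fin 6 × Bool :=
  -- Entries 0 and 3 belong to the deleted edge and are placeholders.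
  (if p.2 then ![0, 2, 4, 3, 5, 1] p.1 else ![0, 5, 1, 3, 2, 4] p.1, !p.2)

theorem verDelete_B3 (p : Fin 6 × Bool) (hp : p.1 ≠ 0 ∧ p.1 ≠ 3) :
    B3.verDelete ((0 : Fin 6), false) p = verB3Sub p := by
  have key : ∀ p : Fin 6 × Bool, p.1 ≠ 0 ∧ p.1 ≠ 3 →
      let f : Fin 6 × Bool → Fin 6 × Bool := fun p => (if p.2 then p.1 + 1 else p.1 - 1, !p.2)
      ((f p).1 = 0 ∨ (f p).1 = 3 → f ((f p).1, !(f p).2) = verB3Sub p) ∧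
      (¬ ((f p).1 = 0 ∨ (f p).1 = 3) → f p = verB3Sub p) := by decide
  have h1 := B3_mem_edgeFlags (B3.ver p)
  have h2 := B3_mem_edgeFlags (B3.ver (B3.com (B3.ver p)))
  by_cases h : B3.ver p ∈ B3.edgeFlags ((0 : Fin 6), false)
  · have h3 := h1.1 h
    have h4 : B3.ver (B3.com (B3.ver p)) ∉ B3.edgeFlags ((0 : Fin 6), false) := by
      refine mt h2.1 ?_
      clear h h1 h2 key
      revert p
      decide
    refine (if_neg (not_not.2 h)).trans ((if_pos h4).trans ?_)
    exact (key p hp).1 h3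
  · refine (if_pos h).trans ?_
    exact (key p hp).2 (mt h1.2 h)

theorem isolated_B3_sub_e : B3_sub_e.isolated = 0 := by
  have h1 : ∀ k : Fin 6, B3.vertexSetoid ((k, false) : Fin 6 × Bool) ((k, true) : Fin 6 × Bool) :=
    fun k => .rel _ _ (.inl rfl)
  have h2 : ∀ k : Fin 6, B3.vertexSetoid ((k, true) : Fin 6 × Bool)
      ((k + 1, false) : Fin 6 × Bool) :=
    fun k => .rel _ _ (.inr rfl)
  have h3 : ∀ k : Fin 6, B3.vertexSetoid ((0, false) : Fin 6 × Bool)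
      ((k, false) : Fin 6 × Bool) := by
    intro k
    induction k using Fin.induction with
    | zero => exact B3.vertexSetoid.refl _
    | succ k ih =>
      have := B3.vertexSetoid.trans ih (B3.vertexSetoid.trans (h1 _) (h2 _))
      rwa [Fin.coeSucc_eq_succ] at this
  have h4 : ∀ p : Fin 6 × Bool, B3.vertexSetoid ((1, false) : Fin 6 × Bool) p := by
    rintro ⟨k, _ | _⟩
    · exact B3.vertexSetoid.trans (B3.vertexSetoid.symm (h3 1)) (h3 k)
    · exact B3.vertexSetoid.trans (B3.vertexSetoid.symm (h3 1))
        (B3.vertexSetoid.trans (h3 k) (h1 k))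
  have : IsEmpty {w : Quotient B3.vertexSetoid //
      ∀ y, Quotient.mk B3.vertexSetoid y = w → y ∈ B3.edgeFlags ((0 : Fin 6), false)} := by
    refine ⟨fun ⟨w, hw⟩ => ?_⟩
    obtain ⟨p, rfl⟩ := Quotient.exists_rep w
    have := (B3_mem_edgeFlags ((1, false) : Fin 6 × Bool)).1 (hw _ (Quotient.sound (h4 p)))
    revert this
    decide
  change 0 + Nat.card _ = 0
  rw [Nat.card_of_isEmpty]

theorem not_checkerboardColourable_B3_sub_e : ¬ B3_sub_e.CheckerboardColourable := by
  rw [checkerboardColourable_iff]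
  rintro ⟨κ, hκ⟩
  have m : ∀ p : Fin 6 × Bool, p.1 ≠ 0 ∧ p.1 ≠ 3 → p ∉ B3.edgeFlags ((0 : Fin 6), false) :=
    fun p hp h => by rcases (B3_mem_edgeFlags p).1 h with h | h; exacts [hp.1 h, hp.2 h]
  have hv : ∀ (p : Fin 6 × Bool) (hp : p.1 ≠ 0 ∧ p.1 ≠ 3)
      (hp' : (verB3Sub p).1 ≠ 0 ∧ (verB3Sub p).1 ≠ 3),
      κ ⟨verB3Sub p, m _ hp'⟩ = κ ⟨p, m _ hp⟩ := by
    intro p hp hp'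
    refine Eq.trans (congrArg κ (Subtype.ext ?_)) (hκ.ver ⟨p, m _ hp⟩)
    exact (verDelete_B3 p hp).symm
  -- Two colour changes lead from `(1, false)` to `(4, false)`, so these agree; but `edg` joins `(1,
  -- false)` to `(4, true)`, one further change away.
  have e1 := hκ.com ⟨((1, false) : Fin 6 × Bool), m _ (by decide)⟩
  have e2 := hκ.com ⟨((2, false) : Fin 6 × Bool), m _ (by decide)⟩
  have e3 := hκ.com ⟨((4, false) : Fin 6 × Bool), m _ (by decide)⟩
  have e4 := hκ.edg ⟨((1, false) : Fin 6 × Bool), m _ (by decide)⟩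
  have e5 := hv (1, true) (by decide) (by decide)
  have e6 := hv (2, true) (by decide) (by decide)
  have e7 := (e6.trans e2).trans (congrArg not (e5.trans e1))
  have e8 := e4.symm.trans (e3.trans (congrArg not e7))
  revert e8
  cases κ ⟨((1, false) : Fin 6 × Bool), m _ (by decide)⟩ <;> simp

/-- A component with one vertex and two orientable loops whose ends alternate. -/
theorem hasEulerianMinor_B3_sub_e {G : RibbonGraph.{u}} {ℓ : G.Flag → Bool}
    (hv : ∀ y, ℓ (G.ver y) = ℓ y) (hc : ∀ y, ℓ (G.com y) = !ℓ y) {x y z w : G.Flag}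
    (hxy : G.ver (G.com x) = y) (hyz : G.ver (G.com y) = z) (hzw : G.ver (G.com z) = w)
    (hwx : G.ver (G.com w) = x) (hxz : G.edg x = G.com z) (hyw : G.edg y = G.com w) :
    G.HasEulerianMinor B3_sub_e := by
  have m : ∀ p : B3_sub_e.Flag, (p.1 : Fin 6 × Bool).1 ≠ 0 ∧ (p.1 : Fin 6 × Bool).1 ≠ 3 := by
    intro p
    have := mt (B3_mem_edgeFlags p.1).2 p.2
    tauto
  have c1 := G.com_com
  have c2 := G.com_ne
  have c3 := G.edg_edg
  have c4 := G.edg_ne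
  have c5 := G.com_edg
  have c6 := G.com_edg_ne
  have c7 := G.ver_ver
  have c8 := G.ver_ne
  -- The arrows 1, 2, 4, 5 that remain go to `x`, `y`, `z`, `w`; the entries at 0 and 3 are
  -- placeholders.
  let φ : Fin 6 × Bool → G.Flag := fun p => ![fun y => y, G.com] (if p.2 then 1 else 0)
    (![x, x, y, x, z, w] p.1)
  have key : ∀ {P : Fin 6 × Bool → Prop}, P (1, false) → P (1, true) → P (2, false) → P (2, true) →
      P (4, false) → P (4, true) → P (5, false) → P (5, true) → ∀ p : B3_sub_e.Flag, P p.1 := by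
    intro P h1 h2 h3 h4 h5 h6 h7 h8 p
    have := m p
    generalize (p.1 : Fin 6 × Bool) = q at this
    obtain ⟨k, h⟩ := q
    fin_cases k <;> cases h <;> simp_all
  -- For injectivity, `ℓ` tells `x`, `z` from `y`, `w`, while `x ≠ z` and `y ≠ w` follow from the
  -- positions of the loops and `com_edg_ne`.
  have l2 : ℓ y = !ℓ x := by rw [← hxy, hv, hc]
  have l3 : ℓ z = ℓ x := by rw [← hyz, hv, hc, l2, Bool.not_not]
  have l4 : ℓ w = !ℓ x := by rw [← hzw, hv, hc, l3]
  have inj : ∀ p q : Fin 6 × Bool, p.1 ≠ 0 ∧ p.1 ≠ 3 → q.1 ≠ 0 ∧ q.1 ≠ 3 → φ p = φ q → p = q := by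
    have n1 : x ≠ z := by grind
    have n2 : y ≠ w := by grind
    have n3 : ∀ {a b}, G.ver (G.com a) = b →
        (G.com b ≠ a ∧ a ≠ G.com b) ∧ G.com a ≠ b ∧ b ≠ G.com a := by grind
    have n4 := n3 hxy
    have n5 := n3 hyz
    have n6 := n3 hzw
    have n7 := n3 hwx
    have n8 : ∀ {a b}, ℓ b = (!ℓ a) → a ≠ b ∧ b ≠ a := by grind
    have l5 : ℓ w = !ℓ z := by rw [l3, l4]
    have l6 : ℓ z = !ℓ y := by rw [l3, l2, Bool.not_not]
    have m1 := n8 l2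
    have m2 := n8 l4
    have m3 := n8 l5
    have m4 := n8 l6
    have c : ∀ {a b}, G.com a = G.com b ↔ a = b := fun {a b} =>
      ⟨fun h => by rw [← c1 a, h, c1], fun h => h ▸ rfl⟩
    have m5 : ∀ {a b}, ℓ a = ℓ b →
        (G.com a ≠ b ∧ b ≠ G.com a) ∧ G.com b ≠ a ∧ a ≠ G.com b := by grind
    have m6 := m5 l3
    have m7 := m5 (l2.trans l4.symm)
    clear hxy hyz hzw hwx hxz hyw m5 n3 n8 l2 l3 l4 l5 l6 key hv hc m
    have c2' := fun a => (c2 a).symm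
    rintro ⟨k, h⟩ ⟨k', h'⟩ hp hq
    fin_cases k <;> first | exact absurd rfl hp.1 | exact absurd rfl hp.2 | skip
    all_goals fin_cases k' <;> first | exact absurd rfl hq.1 | exact absurd rfl hq.2 | skip
    all_goals
      cases h <;> cases h' <;> intro e <;> first | rfl | skip
    all_goals
      simp [φ, *, n1.symm, n2.symm] at e
  refine hasEulerianMinor_of_injective (K := B3_sub_e) isolated_B3_sub_e _ G rfl
    (fun p => φ p.1) (fun p q h => Subtype.ext (inj _ _ (m p) (m q) h)) ?_ ?_ ?_
  · intro p
    change φ (B3.com p.1) = G.com (φ p.1)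
    exact key (P := fun q => φ (B3.com q) = G.com (φ q)) rfl (c1 x).symm rfl (c1 y).symm rfl
      (c1 z).symm rfl (c1 w).symm p
  · intro p
    refine (congrArg φ (verDelete_B3 p.1 (m p))).trans ?_
    have e : ∀ {a b}, G.ver a = b → a = G.ver b := fun h => h ▸ (c7 _).symm
    exact key (P := fun q => φ (verB3Sub q) = G.ver (φ q)) (e hwx) hxy.symm (e hxy) hyz.symm
      (e hyz) hzw.symm (e hzw) hwx.symm p
  · intro p
    change φ (B3.edg p.1) = G.edg (φ p.1)
    have e : ∀ {a b}, G.edg a = G.com b → b = G.edg (G.com a) := by grind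
    have e' : ∀ {a b}, G.edg a = G.com b → a = G.edg (G.com b) := by grind
    have e'' : ∀ {a b}, G.edg a = G.com b → G.com a = G.edg b := by grind
    exact key (P := fun q => φ (B3.edg q) = G.edg (φ q)) hxz.symm (e hxz) hyw.symm (e hyw)
      (e'' hxz) (e' hxz) (e'' hyw) (e' hyw) p

end Targets

/-! ### Walks round a vertex and parity -/

section Orbits

variable (G : RibbonGraph.{u})

theorem nextVertexSegment_injective : Function.Injective G.nextVertexSegment := by
  intro y z h
  have h1 := congrArg G.com h
  simp only [nextVertexSegment, G.com_com] at h1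
  rw [← G.ver_ver y, h1, G.ver_ver]

/-- `ver` conjugates `nextVertexSegment` to its inverse: it reverses the direction of travel. -/
theorem iterate_nextVertexSegment_ver (k : ℕ) (y : G.Flag) :
    G.nextVertexSegment^[k] (G.ver (G.nextVertexSegment^[k] y)) = G.ver y := by
  induction k with
  | zero => rfl
  | succ k ih =>
    rw [Function.iterate_succ_apply, Function.iterate_succ_apply' _ _ y]
    refine Eq.trans (congrArg _ ?_) ih
    simp only [nextVertexSegment, G.ver_ver, G.com_com]

/-- The two directions round a vertex boundary are different. -/
theorem iterate_nextVertexSegment_ne_ver (k : ℕ) :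
    ∀ y : G.Flag, G.nextVertexSegment^[k] y ≠ G.ver y := by
  induction k using Nat.strong_induction_on with
  | _ k ih =>
  intro y h
  match k with
  | 0 => exact G.ver_ne y h.symm
  | 1 => exact G.com_ne _ h
  | k + 2 =>
    -- Removing a step at each end shortens the walk by two, down to a segment whose end points
    -- would coincide.
    refine ih k (by omega) (G.nextVertexSegment y) (G.nextVertexSegment_injective ?_)
    rw [← Function.iterate_succ_apply' G.nextVertexSegment, ← Function.iterate_succ_apply, h]
    simp only [nextVertexSegment, G.ver_ver, G.com_com]

theorem iterate_nextVertexSegment_ne_ver_iterate (k l : ℕ) (y : G.Flag) :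
    G.nextVertexSegment^[k] y ≠ G.ver (G.nextVertexSegment^[l] y) := by
  intro h
  refine G.iterate_nextVertexSegment_ne_ver (l + k) y ?_
  rw [Function.iterate_add_apply, h, iterate_nextVertexSegment_ver]

theorem exists_iterate_nextVertexSegment_eq (y : G.Flag) :
    ∃ p, 0 < p ∧ G.nextVertexSegment^[p] y = y := by
  have := G.finite
  obtain ⟨p, hp, h⟩ := Function.Injective.mem_periodicPts G.nextVertexSegment_injective y
  exact ⟨p, hp, h⟩

theorem exists_firstHit {α : Type u} {f : α → α} {a b : α} (h : ∃ n, f^[n] a = b) :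
    ∃ n, FirstHit f a b n := by
  classical
  exact ⟨Nat.find h, Nat.find_spec h, fun m hm => Nat.find_min h hm⟩

variable {G}

theorem evenlySeparated_two {a : G.Flag} (h1 : G.nextVertexSegment a ≠ a)
    (h2 : G.nextVertexSegment (G.nextVertexSegment a) ≠ a) :
    G.EvenlySeparated a (G.nextVertexSegment (G.nextVertexSegment a)) := by
  obtain ⟨m, hm⟩ : ∃ m, FirstHit G.nextVertexSegment
      (G.nextVertexSegment (G.nextVertexSegment a)) a m := by
    apply exists_firstHit
    obtain ⟨p, hp, h⟩ := G.exists_iterate_nextVertexSegment_eq a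
    match p with
    | 1 => exact absurd h h1
    | p + 2 => exact ⟨p, h⟩
  refine ⟨2, m, ⟨rfl, fun k hk => ?_⟩, hm, .inl (by decide)⟩
  interval_cases k
  · exact h2.symm
  · exact fun h => h1 (G.nextVertexSegment_injective h).symm

/-- The degree of the vertex divides `k`, hence is odd; the long way back from the next segment to
`a` crosses one common line segment less, an even number. -/
theorem evenlySeparated_one {a : G.Flag} (h1 : G.nextVertexSegment a ≠ a) {k : ℕ} (hk : Odd k)
    (h : G.nextVertexSegment^[k] a = a) : G.EvenlySeparated a (G.nextVertexSegment a) := by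
  obtain ⟨d, hd⟩ : ∃ d, d = Function.minimalPeriod G.nextVertexSegment a := ⟨_, rfl⟩
  have hdk : d ∣ k := hd ▸ Function.IsPeriodicPt.minimalPeriod_dvd h
  have hodd : Odd d := hk.of_dvd_nat hdk
  have hper : G.nextVertexSegment^[d] a = a := hd ▸ Function.iterate_minimalPeriod
  obtain ⟨e, he⟩ := hodd
  refine ⟨1, 2 * e, ⟨rfl, fun m hm => ?_⟩, ⟨?_, fun m hm h' => ?_⟩, .inr (by simp)⟩
  · interval_cases m
    exact h1.symm
  · rw [← Function.iterate_succ_apply, Nat.succ_eq_add_one, ← he, hper]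
  · refine Function.not_isPeriodicPt_of_pos_of_lt_minimalPeriod (n := m + 1) (by omega)
      (by omega) ?_ (f := G.nextVertexSegment) (x := a)
    exact h'

theorem properContraction_of_not_vertexSetoid {x : G.Flag}
    (h : ¬ G.vertexSetoid x (G.edg x)) : G.ProperContraction x := by
  rintro ⟨k, -, n, m, ⟨h1, -⟩, -⟩
  have key : ∀ j, G.vertexSetoid x (G.nextCommon^[j] x) := by
    intro j
    induction j with
    | zero => exact G.vertexSetoid.refl x
    | succ j ih =>
      rw [Function.iterate_succ_apply']
      exact G.vertexSetoid.trans ih (G.vertexSetoid.trans (.rel _ _ (.inl rfl))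
        (.rel _ _ (.inr rfl)))
  have := key (n + 1)
  rw [h1] at this
  exact h (G.vertexSetoid.trans this (G.vertexSetoid.symm (.rel _ _ (.inl rfl))))

/-- A set of flags that is constant along vertex line segments, and along common line segments
with one possible exception, is constant along that one as well. -/
theorem com_eq_of_forall_ne (S : Set G.Flag) (hc : ∀ z ∈ S, G.com z ∈ S)
    (hv : ∀ z ∈ S, G.ver z ∈ S) {x : G.Flag} (hx : x ∈ S) (μ : G.Flag → Bool)
    (μv : ∀ z ∈ S, μ (G.ver z) = μ z)
    (μc : ∀ z ∈ S, z ≠ x → z ≠ G.com x → μ (G.com z) = μ z) : μ (G.com x) = μ x := by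
  classical
  have := G.finite
  cases nonempty_fintype G.Flag
  -- Flags with `μ` true are counted mod 2: `ver` pairs them off on all of `S`, and `com` does so on
  -- `S` without `x` and `com x`. Hence `μ` agrees at these two.
  let f : G.Flag → ZMod 2 := fun z => if μ z then 1 else 0
  have two : ∀ a b, μ a = μ b → f b + f a = 0 := by
    intro a b h
    simp only [f, h]
    split_ifs <;> decide
  have s1 : ∑ z ∈ S.toFinset, f z = 0 := by
    refine Finset.sum_involution (fun z _ => G.ver z) (fun z hz => ?_) (fun z _ _ => G.ver_ne z)
      (fun z hz => ?_) fun z _ => G.ver_ver z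
    · exact two _ _ (μv z (Set.mem_toFinset.1 hz))
    · exact Set.mem_toFinset.2 (hv z (Set.mem_toFinset.1 hz))
  have s2 : ∑ z ∈ (S.toFinset.erase x).erase (G.com x), f z = 0 := by
    have hcom : ∀ {z w}, G.com z = w → z = G.com w := fun h => h ▸ (G.com_com _).symm
    refine Finset.sum_involution (fun z _ => G.com z) (fun z hz => ?_) (fun z _ _ => G.com_ne z)
      (fun z hz => ?_) fun z _ => G.com_com z
    · simp only [Finset.mem_erase, Set.mem_toFinset] at hz
      exact two _ _ (μc z hz.2.2 hz.2.1 hz.1)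
    · simp only [Finset.mem_erase, Set.mem_toFinset] at hz ⊢
      exact ⟨fun h => hz.2.1 ((hcom h).trans (G.com_com x)), fun h => hz.1 (hcom h),
        hc z hz.2.2⟩
  rw [← Finset.add_sum_erase _ _ (Set.mem_toFinset.2 hx), ← Finset.add_sum_erase _ _
    (Finset.mem_erase.2 ⟨G.com_ne x, Set.mem_toFinset.2 (hc x hx)⟩), s2] at s1
  revert s1
  simp only [f]
  cases μ x <;> cases μ (G.com x) <;> simp

/-- Going round a vertex with an even number of common line segments, its flags can be coloured
alternately. -/
theorem exists_vertexColouring (y : G.Flag) (hy : ∀ k, G.nextVertexSegment^[k] y = y → Even k) :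
    ∃ ℓ : G.Flag → Bool, ∀ z, G.vertexSetoid y z →
      ℓ (G.ver z) = ℓ z ∧ ℓ (G.com z) = !ℓ z := by
  classical
  obtain ⟨p, hp, hpy⟩ := G.exists_iterate_nextVertexSegment_eq y
  have hpe := hy p hpy
  -- `R z k` says that `k` steps from `y` lead to the vertex line segment of `z`, entered at either
  -- end; the colour of `z` will be the parity of `k`.
  let R : G.Flag → ℕ → Prop := fun z k =>
    G.nextVertexSegment^[k] y = z ∨ G.nextVertexSegment^[k] y = G.ver z
  have Rv : ∀ {z k}, R z k → R (G.ver z) k := by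
    rintro z k (h | h)
    exacts [.inr (h.trans (G.ver_ver z).symm), .inl h]
  have Rc : ∀ {z k}, R z k → ∃ l, (Even l ↔ ¬ Even k) ∧ R (G.com z) l := by
    rintro z k (h | h)
    -- This is one step backwards; the even period `p` avoids truncated subtraction at `k = 0`.
    · refine ⟨k + p - 1, ?_, .inr (G.nextVertexSegment_injective ?_)⟩
      · obtain ⟨q, rfl⟩ := hpe
        rw [show k + (q + q) - 1 = k + 1 + (2 * (q - 1)) by omega]
        simp [Nat.even_add, parity_simps]
      · rw [← Function.iterate_succ_apply' G.nextVertexSegment,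
          show (k + p - 1).succ = k + p by omega, Function.iterate_add_apply, hpy, h]
        simp only [nextVertexSegment, G.ver_ver, G.com_com]
    · refine ⟨k + 1, by simp [parity_simps], .inl ?_⟩
      rw [Function.iterate_succ_apply', h, nextVertexSegment, G.ver_ver]
  -- The parity is well defined: all return times are even, and a walk never meets a segment from
  -- both ends.
  have Ru : ∀ {z k l}, R z k → R z l → (Even k ↔ Even l) := by
    have key : ∀ k l, G.nextVertexSegment^[k] y = G.nextVertexSegment^[l] y →
        (Even k ↔ Even l) := by
      intro k l h
      have h1 := hy _ (Function.iterate_cancel G.nextVertexSegment_injective h)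
      have h2 := hy _ (Function.iterate_cancel G.nextVertexSegment_injective h.symm)
      rcases le_total k l with h | h
      · rw [Nat.even_sub h] at h2; exact h2.symm
      · rw [Nat.even_sub h] at h1; exact h1
    rintro z k l (h | h) (h' | h')
    · exact key k l (h.trans h'.symm)
    · exact absurd (h'.trans (congrArg _ h.symm)) (G.iterate_nextVertexSegment_ne_ver_iterate _ _ _)
    · exact absurd (h.trans (congrArg _ h'.symm)) (G.iterate_nextVertexSegment_ne_ver_iterate _ _ _)
    · exact key k l (h.trans h'.symm)
  let ℓ : G.Flag → Bool := fun z => decide (∃ k, Even k ∧ R z k)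
  have hℓ : ∀ {z k}, R z k → ℓ z = decide (Even k) := by
    intro z k h
    refine decide_eq_decide.2 ⟨fun ⟨l, hl, h'⟩ => (Ru h h').2 hl, fun hk => ⟨k, hk, h⟩⟩
  refine ⟨ℓ, fun z hz => ?_⟩
  obtain ⟨k, hk⟩ : ∃ k, R z k := by
    refine (mem_iff_of_vertexSetoid (S := {z | ∃ k, R z k}) ?_ ?_ hz).1 ⟨0, .inl rfl⟩
    · rintro w ⟨k, hk⟩
      obtain ⟨l, -, h⟩ := Rc hk
      exact ⟨l, h⟩
    · rintro w ⟨k, hk⟩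
      exact ⟨k, Rv hk⟩
  obtain ⟨l, hl, h⟩ := Rc hk
  exact ⟨by rw [hℓ hk, hℓ (Rv hk)], by rw [hℓ hk, hℓ h, ← decide_not, decide_eq_decide]; exact hl⟩

/-- An alternating colouring of the flags round each vertex. -/
structure IsVertexColouring (G : RibbonGraph.{u}) (ℓ : G.Flag → Bool) : Prop where
  ver : ∀ y, ℓ (G.ver y) = ℓ y
  com : ∀ y, ℓ (G.com y) = !ℓ y

theorem exists_isVertexColouring (h : ∀ (y : G.Flag) k, G.nextVertexSegment^[k] y = y → Even k) :
    ∃ ℓ, G.IsVertexColouring ℓ := by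
  choose ℓ hℓ using fun y => exists_vertexColouring y (h y)
  let r : G.Flag → G.Flag := fun y => (Quotient.mk G.vertexSetoid y).out
  have h1 : ∀ y, G.vertexSetoid (r y) y := fun y => Quotient.mk_out (s := G.vertexSetoid) y
  have h2 : ∀ y, r (G.ver y) = r y := fun y => congrArg Quotient.out
    (Quotient.sound (s := G.vertexSetoid) (G.vertexSetoid.symm (.rel _ _ (.inr rfl))))
  have h3 : ∀ y, r (G.com y) = r y := fun y => congrArg Quotient.out
    (Quotient.sound (s := G.vertexSetoid) (G.vertexSetoid.symm (.rel _ _ (.inl rfl))))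
  refine ⟨fun y => ℓ (r y) y, fun y => ?_, fun y => ?_⟩
  · simp only [h2]; exact (hℓ _ _ (h1 y)).1
  · simp only [h3]; exact (hℓ _ _ (h1 y)).2

end Orbits

/-! ### Reductions at odd vertices, non-loops and disconnected graphs -/

section Obstructions

/-- One of the three obstructions to checkerboard colourability is an Eulerian minor. -/
def HasObstruction (G : RibbonGraph.{u}) : Prop :=
  G.HasEulerianMinor B1.dual ∨ G.HasEulerianMinor B1bar ∨ G.HasEulerianMinor B3_sub_e

theorem HasObstruction.of_step {G H : RibbonGraph.{u}} (h : EulerianStep G H)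
    (hH : H.HasObstruction) : G.HasObstruction :=
  hH.imp (.of_step h) (.imp (.of_step h) (.of_step h))

/-- All ribbon graphs with fewer flags than `G` satisfy the theorem. -/
def SmallerHaveObstructions (G : RibbonGraph.{u}) : Prop :=
  ∀ H : RibbonGraph.{u}, Nat.card H.Flag < Nat.card G.Flag → ¬ H.CheckerboardColourable →
    H.HasObstruction

variable {G : RibbonGraph.{u}}

theorem card_split (a b : G.Flag) (hab : a ≠ b) (hab' : G.ver a ≠ b) :
    Nat.card (G.split a b hab hab').Flag = Nat.card G.Flag :=
  (Nat.card_congr (G.exists_equiv_split a b hab hab').choose).symm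

/-- Splitting keeps the number of flags, so the induction hypothesis remains available after a
split. -/
theorem SmallerHaveObstructions.split (ih : G.SmallerHaveObstructions) (a b : G.Flag)
    (hab : a ≠ b) (hab' : G.ver a ≠ b) : (G.split a b hab hab').SmallerHaveObstructions :=
  fun H hH => ih H (hH.trans_eq (card_split a b hab hab'))

/-- A union of components can be split off. -/
theorem hasObstruction_of_closed (ih : G.SmallerHaveObstructions)
    (hG : ¬ G.CheckerboardColourable) {S : Set G.Flag} (hc : ∀ z ∈ S, G.com z ∈ S)
    (hv : ∀ z ∈ S, G.ver z ∈ S) (he : ∀ z ∈ S, G.edg z ∈ S) {s t : G.Flag} (hs : s ∈ S)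
    (ht : t ∉ S) : G.HasObstruction := by
  classical
  have key : ∀ w, ¬ G.HasObstruction → ∃ κ : G.Flag → Bool, ∀ z, ¬ G.componentSetoid w z →
      κ (G.ver z) = κ z ∧ κ (G.edg z) = κ z ∧ κ (G.com z) = !κ z := by
    intro w hno
    have col : (G.deleteComponent w).CheckerboardColourable := by
      by_contra h
      exact hno (.of_step (.deleteComponent G w) (ih _ (card_deleteComponent_lt w) h))
    obtain ⟨κ, hκ⟩ := (checkerboardColourable_iff _).1 col
    obtain ⟨g, hg⟩ : ∃ g : G.Flag → Bool, ∀ y : (G.deleteComponent w).Flag, g y.1 = κ y :=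
      ⟨_, Subtype.val_injective.extend_apply κ fun _ => false⟩
    refine ⟨g, fun z hz => ?_⟩
    have h1 := hg ⟨z, hz⟩
    have h2 := (hg ((G.deleteComponent w).ver ⟨z, hz⟩)).trans (hκ.ver _)
    have h3 := (hg ((G.deleteComponent w).edg ⟨z, hz⟩)).trans (hκ.edg _)
    have h4 := (hg ((G.deleteComponent w).com ⟨z, hz⟩)).trans (hκ.com _)
    rw [← h1] at h2 h3 h4
    exact ⟨h2, h3, h4⟩
  by_contra hno
  obtain ⟨κ₁, h1⟩ := key s hno
  obtain ⟨κ₂, h2⟩ := key t hno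
  have n1 : ∀ z, z ∉ S → ¬ G.componentSetoid s z :=
    fun z hz h => hz ((mem_iff_of_componentSetoid hc hv he h).1 hs)
  have n2 : ∀ z, z ∈ S → ¬ G.componentSetoid t z :=
    fun z hz h => ht ((mem_iff_of_componentSetoid hc hv he h).2 hz)
  have hc' := mem_iff_of_involutive G.com_com hc
  have hv' := mem_iff_of_involutive G.ver_ver hv
  have he' := mem_iff_of_involutive G.edg_edg he
  -- Deleting the component of `t` leaves all of `S`, and deleting that of `s` leaves the whole
  -- complement, so the two colourings glue along `S`.
  refine hG ((checkerboardColourable_iff _).2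
    ⟨fun z => if z ∈ S then κ₂ z else κ₁ z, fun z => ?_, fun z => ?_, fun z => ?_⟩) <;>
    simp only [← hc', ← hv', ← he'] <;> split_ifs with hz
  exacts [(h2 z (n2 z hz)).1, (h1 z (n1 z hz)).1, (h2 z (n2 z hz)).2.1, (h1 z (n1 z hz)).2.1,
    (h2 z (n2 z hz)).2.2, (h1 z (n1 z hz)).2.2]

theorem vertexSetoid_com (x : G.Flag) : G.vertexSetoid x (G.com x) := .rel _ _ (.inl rfl)

theorem vertexSetoid_ver (x : G.Flag) : G.vertexSetoid x (G.ver x) := .rel _ _ (.inr rfl)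

/-- Contracting an edge that is not a loop, in a ribbon graph with even vertices. -/
theorem hasObstruction_of_nonloop (ih : G.SmallerHaveObstructions)
    (hG : ¬ G.CheckerboardColourable) {ℓ : G.Flag → Bool} (hℓ : G.IsVertexColouring ℓ) {x : G.Flag}
    (hx : ¬ G.vertexSetoid x (G.edg x)) : G.HasObstruction := by
  refine .of_step (.contract G x (properContraction_of_not_vertexSetoid hx))
    (ih _ (G.card_contract_lt x) fun h => hG ?_)
  obtain ⟨κ, hκ⟩ := (G.contract_checkerboardColourable_iff x).1 h
  -- When only one end of the edge lies at the vertex of `y`, `κ xor ℓ` is unchanged across all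
  -- other common line segments there, so by parity across that one too.
  have key : ∀ y, (∀ z, G.vertexSetoid y z → z ≠ y → z ≠ G.com y → z ∉ G.edgeFlags x) →
      κ (G.com y) = !κ y := by
    intro y hy
    have := com_eq_of_forall_ne {z | G.vertexSetoid y z}
      (fun z hz => G.vertexSetoid.trans hz (vertexSetoid_com z))
      (fun z hz => G.vertexSetoid.trans hz (vertexSetoid_ver z)) (G.vertexSetoid.refl y)
      (fun z => κ z ^^ ℓ z) (fun z _ => by simp only [hκ.ver, hℓ.ver])
      (fun z hz h1 h2 => by simp only [hκ.com z (hy z hz h1 h2), hℓ.com, Bool.not_xor_not])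
    simp only [hℓ.com] at this
    revert this
    cases κ (G.com y) <;> cases κ y <;> cases ℓ y <;> simp
  have hx' : ¬ G.vertexSetoid x (G.com (G.edg x)) := fun h =>
    hx (G.vertexSetoid.trans h (G.vertexSetoid.symm (vertexSetoid_com _)))
  have k1 : κ (G.com x) = !κ x := by
    refine key x ?_
    rintro z hz h1 h2 (rfl | rfl | rfl | rfl)
    exacts [h1 rfl, h2 rfl, hx hz, hx' hz]
  refine (checkerboardColourable_iff _).2 ⟨κ, hκ.ver, hκ.edg, fun y => ?_⟩
  by_cases hy : y ∈ G.edgeFlags x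
  · rcases hy with rfl | rfl | rfl | rfl
    · exact k1
    · rw [G.com_com, k1, Bool.not_not]
    · rw [G.com_edg, hκ.edg, hκ.edg, k1]
    · rw [G.com_com, G.com_edg, hκ.edg, hκ.edg, k1, Bool.not_not]
  · exact hκ.com y hy

theorem verSplit_of_ne {a b z : G.Flag} (h1 : z ≠ a) (h2 : z ≠ G.ver b) (h3 : z ≠ b)
    (h4 : z ≠ G.ver a) : G.verSplit a b z = G.ver z := by
  rw [verSplit, if_neg h1, if_neg h2, if_neg h3, if_neg h4]

/-- An end of an edge at a vertex of odd degree can be split off. -/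
theorem exists_step_ver_eq_com {y : G.Flag} {k : ℕ} (hk : Odd k)
    (h : G.nextVertexSegment^[k] y = y) (hy : G.ver y ≠ G.com y)
    (ih : G.SmallerHaveObstructions) :
    ∃ H : RibbonGraph.{u}, EulerianStep G H ∧ H.SmallerHaveObstructions ∧
      ∃ φ : G.Flag → H.Flag, (∀ z, H.com (φ z) = φ (G.com z)) ∧ (∀ z, H.edg (φ z) = φ (G.edg z)) ∧
        H.ver (φ y) = H.com (φ y) ∧
        ∀ z, G.ver z = G.com z → z ≠ y → z ≠ G.com y → H.ver (φ z) = H.com (φ z) := by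
  have c1 := G.com_com
  have c2 := G.ver_ver
  have c3 := G.com_ne
  have c4 := G.ver_ne
  have e : G.nextVertexSegment (G.ver y) = G.com y := congrArg G.com (c2 y)
  have h' : G.nextVertexSegment^[k] (G.ver y) = G.ver y := by
    have := G.iterate_nextVertexSegment_ver k y
    rwa [h] at this
  -- The two vertex line segments are the neighbours of the common line segment at `y`, which the
  -- split isolates.
  have sep : G.EvenlySeparated (G.ver y) (G.com y) :=
    e ▸ evenlySeparated_one (fun h => hy (h.symm.trans e)) hk h'
  have hab' : G.ver (G.ver y) ≠ G.com y := fun h => c3 y (h.symm.trans (c2 y))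
  obtain ⟨φ, hφ⟩ := G.exists_equiv_split (G.ver y) (G.com y) hy hab'
  refine ⟨_, .split G _ _ hy hab' sep, ih.split _ _ _ _, φ, fun z => (hφ z).1,
    fun z => (hφ z).2.2, ?_, fun z hz h1 h2 => ?_⟩
  · rw [(hφ y).1, (hφ y).2.1]
    refine congrArg φ ?_
    rw [verSplit, if_neg (c4 y).symm, if_neg, if_neg (c3 y).symm, if_pos (c2 y).symm]
    exact fun h => hy ((congrArg G.ver h).trans (c2 _))
  · rw [(hφ z).1, (hφ z).2.1]
    refine congrArg φ ?_
    rw [verSplit_of_ne _ _ h2 (by rwa [c2]), hz] <;> grind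

/-- The edge of `x` ends at a vertex of degree one; the parity of its other end decides between
producing `B1.dual` and contracting. -/
theorem hasObstruction_of_ver_eq_com (ih : G.SmallerHaveObstructions) {x : G.Flag}
    (hx : G.ver x = G.com x) : G.HasObstruction := by
  have c1 := G.com_com
  have c2 := G.ver_ver
  by_cases hy : G.ver (G.edg x) = G.com (G.edg x)
  · exact .inl (hasEulerianMinor_B1_dual hx hy)
  by_cases hodd : ∃ k, Odd k ∧ G.nextVertexSegment^[k] (G.edg x) = G.edg x
  · obtain ⟨k, hk, h⟩ := hodd
    obtain ⟨H, hH, -, φ, h1, h2, h3, h4⟩ := exists_step_ver_eq_com hk h hy ih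
    refine .of_step hH (.inl (hasEulerianMinor_B1_dual (x := φ x) ?_ ?_))
    · refine h4 x hx (G.edg_ne x).symm ?_
      exact (G.com_edg_ne x).symm
    · rw [h2]; exact h3
  · have heven : ∀ k, G.nextVertexSegment^[k] (G.edg x) = G.edg x → Even k := fun k hk => by
      by_contra h
      exact hodd ⟨k, Nat.not_even_iff_odd.1 h, hk⟩
    obtain ⟨ℓ, hℓ⟩ := exists_vertexColouring _ heven
    have hS : ∀ z, G.vertexSetoid x z → z = x ∨ z = G.com x := by
      intro z hz
      refine (mem_iff_of_vertexSetoid (S := {z | z = x ∨ z = G.com x}) ?_ ?_ hz).1 (.inl rfl)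
      · rintro w (rfl | rfl)
        exacts [.inr rfl, .inl (c1 _)]
      · rintro w (rfl | rfl)
        exacts [.inr hx, .inl (hx ▸ c2 x)]
    have hn : ¬ G.vertexSetoid x (G.edg x) := fun h => by
      rcases hS _ h with h | h
      · exact G.edg_ne x h
      · exact G.com_edg_ne x (by rw [h, c1])
    refine .of_step (.contract G x (properContraction_of_not_vertexSetoid hn))
      (ih _ (G.card_contract_lt x) fun h => ?_)
    obtain ⟨κ, hκ⟩ := (G.contract_checkerboardColourable_iff x).1 h
    -- Since `ver x = com x`, the colour does not change across the end of degree one, nor then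
    -- across the other end. Parity of `κ xor ℓ` at the even vertex forbids this.
    have k1 : κ (G.com (G.edg x)) = κ (G.edg x) := by
      rw [G.com_edg, hκ.edg, hκ.edg, ← hx, hκ.ver]
    have := com_eq_of_forall_ne {z | G.vertexSetoid (G.edg x) z}
      (fun z hz => G.vertexSetoid.trans hz (vertexSetoid_com z))
      (fun z hz => G.vertexSetoid.trans hz (vertexSetoid_ver z)) (G.vertexSetoid.refl _)
      (fun z => κ z ^^ ℓ z) (fun z hz => by simp only [hκ.ver, (hℓ z hz).1])
      (fun z hz h1 h2 => by
        have : z ∉ G.edgeFlags x := by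
          rintro (rfl | rfl | rfl | rfl)
          · exact hn (G.vertexSetoid.symm hz)
          · exact hn (G.vertexSetoid.trans (vertexSetoid_com x) (G.vertexSetoid.symm hz))
          · exact h1 rfl
          · exact h2 rfl
        simp only [hκ.com z this, (hℓ z hz).2, Bool.not_xor_not])
    simp only [(hℓ _ (G.vertexSetoid.refl _)).2, k1] at this
    revert this
    cases κ (G.edg x) <;> cases ℓ (G.edg x) <;> simp

theorem hasObstruction_of_odd (ih : G.SmallerHaveObstructions) {x : G.Flag} {k : ℕ} (hk : Odd k)
    (h : G.nextVertexSegment^[k] x = x) : G.HasObstruction := by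
  by_cases hx : G.ver x = G.com x
  · exact hasObstruction_of_ver_eq_com ih hx
  · obtain ⟨H, hH, ih', φ, -, -, h3, -⟩ := exists_step_ver_eq_com hk h hx ih
    exact .of_step hH (hasObstruction_of_ver_eq_com ih' h3)

end Obstructions

/-! ### Bouquets with even vertices -/

section Loops

variable {G : RibbonGraph.{u}}

/-- The flags of two consecutive common line segments on a vertex boundary. -/
def consecutiveFlags (G : RibbonGraph.{u}) (y : G.Flag) : Set G.Flag :=
  {y, G.com y, G.ver (G.com y), G.com (G.ver (G.com y))}

theorem mem_consecutiveFlags {y z : G.Flag} : z ∈ G.consecutiveFlags y ↔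
    z = y ∨ z = G.com y ∨ z = G.ver (G.com y) ∨ z = G.com (G.ver (G.com y)) := Iff.rfl

theorem com_mem_consecutiveFlags {y z : G.Flag} (h : z ∈ G.consecutiveFlags y) :
    G.com z ∈ G.consecutiveFlags y := by
  have := G.com_com
  rw [mem_consecutiveFlags] at h ⊢
  grind

/-- If splitting off two consecutive common line segments makes a bouquet with even vertices
checkerboard colourable, then the loops that meet the two parts are just those that violate the
alternating colouring. -/
theorem crossing_of_colouring_split {ℓ : G.Flag → Bool} (hℓ : G.IsVertexColouring ℓ)
    (hloop : ∀ z, G.vertexSetoid z (G.edg z)) {x y : G.Flag} (hxy : G.vertexSetoid x y)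
    (hx : ℓ (G.edg x) ≠ ℓ x) (hy : G.ver (G.com (G.ver (G.com y))) ≠ y) {κ : G.Flag → Bool}
    (κv : ∀ z, κ (G.verSplit (G.ver y) (G.com (G.ver (G.com y))) z) = κ z)
    (κc : ∀ z, κ (G.com z) = !κ z) (κe : ∀ z, κ (G.edg z) = κ z) :
    (x ∈ G.consecutiveFlags y ↔ G.edg x ∉ G.consecutiveFlags y) ∧
      ∀ z ∈ G.consecutiveFlags y, G.edg z ∉ G.consecutiveFlags y → ℓ (G.edg z) ≠ ℓ z := by
  classical
  have c1 := G.com_com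
  have c2 := G.ver_ver
  have c4 := G.ver_ne
  have lv := hℓ.ver
  have lc := hℓ.com
  -- `μ` is constant round each vertex of the split graph, and it changes along an edge exactly when
  -- the edge is bad.
  obtain ⟨μ, hμ⟩ : ∃ μ : G.Flag → Bool, ∀ z, μ z = (κ z ^^ ℓ z) := ⟨_, fun _ => rfl⟩
  have lab : ℓ (G.ver y) = ℓ (G.com (G.ver (G.com y))) := by rw [lv, lc, lv, lc, Bool.not_not]
  have μc : ∀ z, μ (G.com z) = μ z := fun z => by rw [hμ, hμ, κc, lc, Bool.not_xor_not]
  have μs : ∀ z, μ (G.verSplit (G.ver y) (G.com (G.ver (G.com y))) z) = μ z := fun z => by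
    rw [hμ, hμ, κv, verSplit_colour lv lab]
  have μa : μ (G.ver (G.com (G.ver (G.com y)))) = μ (G.ver y) := by
    rw [← μs (G.ver y), verSplit, if_pos rfl]
  have μy : μ (G.com (G.ver (G.com y))) = μ y := by
    rw [← μs y, verSplit, if_neg (c4 y).symm, if_neg hy.symm, if_neg, if_pos (c2 y).symm]
    exact fun h => c4 (G.com y) ((congrArg G.com h).trans (c1 _)).symm
  have inside : ∀ z ∈ G.consecutiveFlags y, μ z = μ y := by
    intro z hz
    rcases hz with rfl | rfl | rfl | rfl
    exacts [rfl, μc _, (μc _).symm.trans μy, μy]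
  -- Overwriting `μ` on the pair by its common value at the two outer neighbours gives a function
  -- constant round the vertex of `G`; hence `μ` takes one value on the rest of that vertex.
  obtain ⟨ν, hν⟩ : ∃ ν : G.Flag → Bool,
      ∀ z, ν z = if z ∈ G.consecutiveFlags y then μ (G.ver y) else μ z := ⟨_, fun _ => rfl⟩
  have νin : ∀ z ∈ G.consecutiveFlags y, ν z = μ (G.ver y) := fun z hz => by rw [hν, if_pos hz]
  have νout : ∀ z ∉ G.consecutiveFlags y, ν z = μ z := fun z hz => by rw [hν, if_neg hz]
  have νc : ∀ z, ν (G.com z) = ν z := by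
    intro z
    by_cases hz : z ∈ G.consecutiveFlags y
    · rw [νin z hz, νin _ (com_mem_consecutiveFlags hz)]
    · rw [νout z hz, νout _ (fun h => hz (c1 z ▸ com_mem_consecutiveFlags h)), μc]
  have ν1 : ∀ z ∈ G.consecutiveFlags y, G.ver z ∉ G.consecutiveFlags y → ν (G.ver z) = ν z := by
    intro z hz hz'
    rw [νin z hz, νout _ hz']
    rw [mem_consecutiveFlags] at hz hz'
    rcases hz with rfl | rfl | rfl | rfl
    · rfl
    · exact absurd (.inr (.inr (.inl rfl))) hz'
    · exact absurd (.inr (.inl (c2 _))) hz'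
    · exact μa
  have νv : ∀ z, ν (G.ver z) = ν z := by
    intro z
    by_cases hz : z ∈ G.consecutiveFlags y <;> by_cases hz' : G.ver z ∈ G.consecutiveFlags y
    · rw [νin z hz, νin _ hz']
    · exact ν1 z hz hz'
    · have := ν1 _ hz' (by rwa [c2])
      rw [← this, c2]
    · rw [νout z hz, νout _ hz', ← μs z, verSplit_of_ne]
      · rintro rfl; exact hz' (.inl (c2 y))
      · rintro rfl; exact hz' (.inr (.inr (.inr (c2 _))))
      · rintro rfl; exact hz (.inr (.inr (.inr rfl)))
      · rintro rfl; exact hz (.inl (c2 y))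
  have outside : ∀ z, G.vertexSetoid x z → z ∉ G.consecutiveFlags y → μ z = μ (G.ver y) := by
    intro z hxz hz
    have := (mem_iff_of_vertexSetoid (S := {w | ν w = ν y}) (fun w hw => (νc w).trans hw)
      (fun w hw => (νv w).trans hw) (G.vertexSetoid.trans (G.vertexSetoid.symm hxy) hxz)).1 rfl
    rw [← νout z hz, ← νin y (.inl rfl)]
    exact this
  have μx : μ (G.edg x) ≠ μ x := by
    rw [hμ, hμ, κe]
    revert hx
    cases ℓ (G.edg x) <;> cases ℓ x <;> simp
  refine ⟨⟨fun h1 h2 => μx ?_, fun h2 => ?_⟩, fun z hz hz' h => μx ?_⟩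
  · rw [inside _ h1, inside _ h2]
  · by_contra h1
    exact μx ((outside _ (hloop x) h2).trans (outside _ (G.vertexSetoid.refl x) h1).symm)
  · have hz1 : G.vertexSetoid y z := by
      have h1 := vertexSetoid_com y
      have h2 := G.vertexSetoid.trans h1 (vertexSetoid_ver _)
      rcases hz with rfl | rfl | rfl | rfl
      exacts [G.vertexSetoid.refl _, h1, h2, G.vertexSetoid.trans h2 (vertexSetoid_com _)]
    -- A crossing loop that is not bad would make `μ` equal on both parts, so the loop of `x` could
    -- not be bad.
    have μz : μ (G.edg z) = μ z := by rw [hμ, hμ, κe, h]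
    rw [inside z hz, outside _ (G.vertexSetoid.trans hxy (G.vertexSetoid.trans hz1 (hloop z))) hz']
      at μz
    have all : ∀ w, G.vertexSetoid x w → μ w = μ y := fun w hw => by
      by_cases hwy : w ∈ G.consecutiveFlags y
      · exact inside w hwy
      · rw [outside w hw hwy, μz]
    rw [all _ (hloop x), all _ (G.vertexSetoid.refl x)]

/-- If the split graph were uncolourable, it would have an obstruction: either it contains a
non-loop, or all its edges are loops and the split-off pair is a union of components. So it is
colourable, and the previous lemma applies. -/
theorem crossing (ih : G.SmallerHaveObstructions) (hno : ¬ G.HasObstruction)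
    {ℓ : G.Flag → Bool} (hℓ : G.IsVertexColouring ℓ)
    (hloop : ∀ z, G.vertexSetoid z (G.edg z)) {x y : G.Flag} (hxy : G.vertexSetoid x y)
    (hx : ℓ (G.edg x) ≠ ℓ x) (hy : G.ver (G.com (G.ver (G.com y))) ≠ y) :
    (x ∈ G.consecutiveFlags y ↔ G.edg x ∉ G.consecutiveFlags y) ∧
      ∀ z ∈ G.consecutiveFlags y, G.edg z ∉ G.consecutiveFlags y → ℓ (G.edg z) ≠ ℓ z := by
  have c1 := G.com_com
  have c2 := G.ver_ver
  have c3 := G.com_ne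
  have c4 := G.ver_ne
  have lv := hℓ.ver
  have lc := hℓ.com
  have hyc : G.ver y ≠ G.com y := fun h => by
    have := lv y
    rw [h, lc] at this
    revert this
    cases ℓ y <;> simp
  have e1 : G.nextVertexSegment (G.ver y) = G.com y := congrArg G.com (c2 y)
  have e2 : G.nextVertexSegment (G.nextVertexSegment (G.ver y)) = G.com (G.ver (G.com y)) := by
    rw [e1]; rfl
  have hab : G.ver y ≠ G.com (G.ver (G.com y)) := fun h => hy (by rw [← h, c2])
  have hab' : G.ver (G.ver y) ≠ G.com (G.ver (G.com y)) := by
    rw [c2]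
    intro h
    exact c4 (G.com y) ((congrArg G.com h).trans (c1 _)).symm
  have sep : G.EvenlySeparated (G.ver y) (G.com (G.ver (G.com y))) :=
    e2 ▸ evenlySeparated_two (by rw [e1]; exact hyc.symm) (by rw [e2]; exact hab.symm)
  obtain ⟨φ, hφ⟩ := G.exists_equiv_split _ _ hab hab'
  have step : EulerianStep G _ := .split G _ _ hab hab' sep
  have hℓ' : (G.split _ _ hab hab').IsVertexColouring (ℓ ∘ φ.symm) := by
    constructor <;> intro w <;> obtain ⟨z, rfl⟩ := φ.surjective w <;>
      simp only [hφ, Function.comp_apply, φ.symm_apply_apply]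
    · exact verSplit_colour lv (sep.colour_eq lv lc) z
    · exact lc z
  by_cases col : (G.split _ _ hab hab').CheckerboardColourable
  · obtain ⟨κ, hκ⟩ := (checkerboardColourable_iff _).1 col
    refine crossing_of_colouring_split hℓ hloop hxy hx hy (κ := κ ∘ φ) (fun z => ?_) (fun z => ?_)
      fun z => ?_ <;> simp only [Function.comp_apply]
    · rw [← (hφ z).2.1, hκ.ver]
    · rw [← (hφ z).1, hκ.com]
    · rw [← (hφ z).2.2, hκ.edg]
  exfalso
  by_cases hloop' : ∃ w, ¬ (G.split _ _ hab hab').vertexSetoid w ((G.split _ _ hab hab').edg w)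
  · obtain ⟨w, hw⟩ := hloop'
    exact hno (.of_step step (hasObstruction_of_nonloop (ih.split _ _ _ _) col hℓ' hw))
  push Not at hloop'
  have hc' : ∀ w ∈ φ '' G.consecutiveFlags y, (G.split _ _ hab hab').com w ∈
      φ '' G.consecutiveFlags y := by
    rintro _ ⟨z, hz, rfl⟩
    exact ⟨_, com_mem_consecutiveFlags hz, (hφ z).1.symm⟩
  have hv' : ∀ w ∈ φ '' G.consecutiveFlags y, (G.split _ _ hab hab').ver w ∈
      φ '' G.consecutiveFlags y := by
    rintro _ ⟨z, hz, rfl⟩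
    refine ⟨_, ?_, (hφ z).2.1.symm⟩
    rw [mem_consecutiveFlags] at hz ⊢
    unfold verSplit
    grind
  refine hno (.of_step step (hasObstruction_of_closed (ih.split _ _ _ _) col
    (S := φ '' G.consecutiveFlags y) hc' hv' (fun w hw => ?_) (s := φ y) (t := φ (G.ver y))
    ⟨y, .inl rfl, rfl⟩ ?_))
  · exact (mem_iff_of_vertexSetoid hc' hv' (hloop' w)).1 hw
  · rintro ⟨z, hz, h⟩
    rw [φ.injective h, mem_consecutiveFlags] at hz
    rcases hz with h | h | h | h
    · exact c4 y h
    · exact hyc h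
    · have := congrArg G.ver h
      rw [c2, c2] at this
      exact c3 y this.symm
    · exact hab h

/-- A bouquet with even vertices that is not checkerboard colourable contains an obstruction. -/
theorem hasObstruction_of_loops (ih : G.SmallerHaveObstructions)
    (hG : ¬ G.CheckerboardColourable) {ℓ : G.Flag → Bool} (hℓ : G.IsVertexColouring ℓ)
    (hloop : ∀ z, G.vertexSetoid z (G.edg z)) : G.HasObstruction := by
  by_contra hno
  have c1 := G.com_com
  have c2 := G.ver_ver
  have c3 := G.com_ne
  have c4 := G.ver_ne
  have c5 := G.edg_edg
  have c6 := G.edg_ne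
  have c7 := G.com_edg
  have c8 := G.com_edg_ne
  have lv := hℓ.ver
  have lc := hℓ.com
  obtain ⟨x, hx⟩ : ∃ x, ℓ (G.edg x) ≠ ℓ x := by
    by_contra! h
    exact hG ((checkerboardColourable_iff _).2 ⟨ℓ, lv, h, lc⟩)
  have hvc : ∀ y, G.vertexSetoid y (G.ver (G.com y)) := fun y =>
    G.vertexSetoid.trans (vertexSetoid_com y) (vertexSetoid_ver _)
  by_cases hxx : G.ver (G.com (G.ver (G.com x))) = x
  -- Here the vertex has just two common line segments, and a bad loop on them is non-orientable.
  · have : G.edg x ∈ G.consecutiveFlags x := by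
      refine (mem_iff_of_vertexSetoid (fun z => com_mem_consecutiveFlags) ?_ (hloop x)).1 (.inl rfl)
      intro z hz
      rw [mem_consecutiveFlags] at hz ⊢
      grind
    rw [mem_consecutiveFlags] at this
    have h : G.edg x = G.ver (G.com x) := by grind
    refine hno (.inr (.inl (hasEulerianMinor_B1bar (x := x) ?_ h.symm)))
    rw [h]
    grind
  -- Number the common line segments 0, 1, 2, … from that of `x`. The pair 0, 1 contains only one
  -- end of the loop and the pair 1, 2 contains one as well, so the other end is 2. The loop at 1
  -- then crosses the pair 1, 2 and is bad too.
  have main : ∀ x, ℓ (G.edg x) ≠ ℓ x → G.ver (G.com (G.ver (G.com x))) ≠ x →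
      G.com (G.edg x) = G.ver (G.com (G.ver (G.com x))) ∧
      ℓ (G.edg (G.ver (G.com x))) ≠ ℓ (G.ver (G.com x)) := by
    intro x hx hxx
    have hzz : G.ver (G.com (G.ver (G.com (G.ver (G.com x))))) ≠ G.ver (G.com x) := by
      intro h
      have h1 := congrArg G.com (congrArg G.ver h)
      rw [c2, c2, c1, c1] at h1
      exact hxx h1
    obtain ⟨A1, -⟩ := crossing ih hno hℓ hloop (G.vertexSetoid.refl x) hx hxx
    obtain ⟨A2, A3⟩ := crossing ih hno hℓ hloop (hvc x) hx hzz
    have A3 := A3 (G.ver (G.com x)) (.inl rfl)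
    simp only [mem_consecutiveFlags] at A1 A2 A3
    -- Of the two flags on that common line segment, `ℓ` admits only the one that makes the loop
    -- orientable.
    have hzx : G.edg x = G.com (G.ver (G.com (G.ver (G.com x)))) := by grind
    exact ⟨by grind, A3 (by grind)⟩
  obtain ⟨m1, hz⟩ := main x hx hxx
  obtain ⟨m2, -⟩ := main _ hz (by
    intro h
    have h1 := congrArg G.com (congrArg G.ver h)
    rw [c2, c2, c1, c1] at h1
    exact hxx h1)
  -- The loop seen from its other end gives that `x` is again two places further on, so the vertex
  -- closes up after four common line segments.
  obtain ⟨m3, -⟩ := main (G.com (G.edg x)) (by grind) (by grind)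
  refine hno (.inr (.inr (hasEulerianMinor_B3_sub_e lv lc (x := x) rfl rfl rfl ?_ ?_ ?_))) <;> grind

end Loops

/-! ### The induction on the number of flags -/

theorem hasObstruction_of_not_checkerboardColourable (n : ℕ) :
    ∀ G : RibbonGraph.{u}, Nat.card G.Flag = n → ¬ G.CheckerboardColourable → G.HasObstruction := by
  induction n using Nat.strong_induction_on with
  | _ n ih =>
  intro G hn hG
  have ih' : G.SmallerHaveObstructions := fun H hH => ih _ (hn ▸ hH) H rfl
  by_cases hodd : ∃ (y : G.Flag) (k : ℕ), Odd k ∧ G.nextVertexSegment^[k] y = y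
  · obtain ⟨y, k, hk, h⟩ := hodd
    exact hasObstruction_of_odd ih' hk h
  obtain ⟨ℓ, hℓ⟩ : ∃ ℓ, G.IsVertexColouring ℓ := exists_isVertexColouring fun y k h => by
    by_contra hk
    exact hodd ⟨y, k, Nat.not_even_iff_odd.1 hk, h⟩
  by_cases hloop : ∀ z, G.vertexSetoid z (G.edg z)
  · exact hasObstruction_of_loops ih' hG hℓ hloop
  · push Not at hloop
    obtain ⟨x, hx⟩ := hloop
    exact hasObstruction_of_nonloop ih' hG hℓ hx

end RibbonGraph

theorem mainTheorem1 (G : RibbonGraph.{u}) :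
    G.CheckerboardColourable ↔
      ¬ G.HasEulerianMinor RibbonGraph.B1.dual ∧
      ¬ G.HasEulerianMinor RibbonGraph.B1bar ∧
      ¬ G.HasEulerianMinor RibbonGraph.B3_sub_e := by
  refine ⟨fun hG => ⟨fun h => ?_, fun h => ?_, fun h => ?_⟩, fun ⟨h1, h2, h3⟩ => ?_⟩
  · exact RibbonGraph.not_checkerboardColourable_of_hasEulerianMinor
      RibbonGraph.not_checkerboardColourable_B1_dual h hG
  · exact RibbonGraph.not_checkerboardColourable_of_hasEulerianMinor
      RibbonGraph.not_checkerboardColourable_B1bar h hG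
  · exact RibbonGraph.not_checkerboardColourable_of_hasEulerianMinor
      RibbonGraph.not_checkerboardColourable_B3_sub_e h hG
  · by_contra hG
    rcases RibbonGraph.hasObstruction_of_not_checkerboardColourable _ G rfl hG with h | h | h
    exacts [h1 h, h2 h, h3 h]
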